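/- **Theorem.** Consider a service system with finite sets $\mathcal A$ of demand points and $\mathcal R$ of regimes. Customers originating at $a\in\mathcal A$ and routed to regime $r\in\mathcal R$ arrive at the queue of $r$ according to a Poisson process of rate $\lambda_{ar}\ge 0$; these processes are independent. Regime $r$ is a single-server first-come, first-served queue with unlimited waiting space and i.i.d. exponential service times of rate $\mu_r$, independent across regimes and of all arrivals; at time $0$ the queues may hold arbitrary finite amounts of unfinished work. Put $\Lambda_r=\sum_{a}\lambda_{ar}$ and $\lambda_a=\sum_r\lambda_{ar}$, and assume $\Lambda_r<\mu_r$ for all $r$ and $\sum_r\Lambda_r>0$. Let $$\pi_r=\frac{\Lambda_r}{\sum_{r'\in\mathcal R}\Lambda_{r'}},\qquad r\in\mathcal R .$$ Let $T_n$ be the sojourn time (waiting plus service) of the $n$-th customer arriving to the whole system. Let $t_a\ge 0$ be the deterministic transportation time of demand point $a\in\mathcal A$. Then for every $a\in\mathcal A$ the total (end-to-end) response time $t_a+T_n$ converges in distribution, as $n\to\infty$, to a random variable $R_a$, the steady-state response time, and $R_a$ equals $t_a$ plus a hyperexponential random variable with weights $\pi_r$ and rates $\mu_r-\Lambda_r$: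 $$\mathbb P(R_a\le t)=\begin{cases}0 & \text{if } t<t_a,\\[4pt] 1-\displaystyle\sum_{r\in\mathcal R}\pi_r\,e^{-(\mu_r-\Lambda_r)(t-t_a)} & \text{if } t\ge t_a.\end{cases}$$ Moreover $R_a$ is integrable, with $$\mathbb E[R_a]=t_a+\sum_{r\in\mathcal R}\frac{\pi_r}{\mu_r-\Lambda_r}.$$ If in addition $\lambda_a>0$ and the customers of $a$ are routed by the regime probabilities, that is, $\lambda_{ar}=\pi_r\lambda_a$ for all $r\in\mathcal R$, then the response time of the $n$-th customer originating at $a$ converges in distribution, as $n\to\infty$, to the same $R_a$. -/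

import Mathlib

open MeasureTheory ProbabilityTheory Filter Topology

/-- Parameters of a multi-regime service system with demand points `A` and service regimes `R`:
customers from `a` routed to regime `r` arrive at rate `rate a r`, the server of regime `r` works
at rate `serviceRate r`, and `travel a` is the deterministic transportation time from `a`.
Every regime is stable (utilization `< 1`), and some arrival rate is positive. -/
structure ServiceSystem (A R : Type*) [Fintype A] [Fintype R] where
  rate : A → R → ℝ
  serviceRate : R → ℝ
  travel : A → ℝ
  rate_nonneg : ∀ a r, 0 ≤ rate a r
  travel_nonneg : ∀ a, 0 ≤ travel a
  stable : ∀ r, ∑ a, rate a r < serviceRate r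
  active : ∃ a r, 0 < rate a r

namespace ServiceSystem

variable {A R : Type*} [Fintype A] [Fintype R]

/-- `Λ_r = ∑ a, λ_{ar}`, the aggregate arrival rate to regime `r`. -/
def regimeRate (S : ServiceSystem A R) (r : R) : ℝ := ∑ a, S.rate a r

/-- `λ_a = ∑ r, λ_{ar}`, the total arrival rate of demand point `a`. -/
def demandRate (S : ServiceSystem A R) (a : A) : ℝ := ∑ r, S.rate a r

/-- `π_r = Λ_r / ∑ r', Λ_{r'}`. -/
noncomputable def weight (S : ServiceSystem A R) (r : R) : ℝ :=
  S.regimeRate r / ∑ r', S.regimeRate r'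

/-- The arrival streams: the pairs (demand point, regime) of positive rate. A pair of rate `0`
generates no customer at all. -/
abbrev Stream (S : ServiceSystem A R) : Type _ := {p : A × R // 0 < S.rate p.1 p.2}

instance (S : ServiceSystem A R) : Nonempty S.Stream :=
  let ⟨a, r, h⟩ := S.active
  ⟨⟨(a, r), h⟩⟩

/-- The demand point at which the customers of a stream originate. -/
def Stream.origin {S : ServiceSystem A R} (i : S.Stream) : A := i.1.1

/-- The regime to which the customers of a stream are routed. -/
def Stream.regime {S : ServiceSystem A R} (i : S.Stream) : R := i.1.2

/-- The random input of the system. The customers of stream `i` reach their queue at the points of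
a Poisson process of rate `λ_i`, that is, `gap i 0` and the successive inter-arrival times
`gap i 1, gap i 2, …` are i.i.d. exponential with rate `λ_i`; the `k`-th customer of stream `i`
requires an exponential service time `service i k` with the rate of its regime; all these variables
are independent. At time `0` the server of regime `r` may have an arbitrary amount of unfinished
work `init r` (take `init = 0` for an initially empty system). -/
structure Input (S : ServiceSystem A R) {Ω : Type*} [MeasurableSpace Ω] (P : Measure Ω) where
  gap : S.Stream → ℕ → Ω → ℝ
  service : S.Stream → ℕ → Ω → ℝ
  init : R → Ω → ℝ
  gap_law : ∀ i k, HasLaw (gap i k) (expMeasure (S.rate i.origin i.regime)) P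
  service_law : ∀ i k, HasLaw (service i k) (expMeasure (S.serviceRate i.regime)) P
  indep : iIndepFun (Sum.elim (fun p : S.Stream × ℕ => gap p.1 p.2)
    (fun p : S.Stream × ℕ => service p.1 p.2)) P
  init_aemeasurable : ∀ r, AEMeasurable (init r) P
  init_nonneg : ∀ r, ∀ᵐ ω ∂P, 0 ≤ init r ω

namespace Input

variable {S : ServiceSystem A R} {Ω : Type*} [MeasurableSpace Ω] {P : Measure Ω}

/-- The arrival time of the `k`-th customer (counted from `0`) of stream `i`. -/
def arrivalTime (X : S.Input P) (i : S.Stream) (k : ℕ) (ω : Ω) : ℝ :=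
  ∑ j ∈ Finset.range (k + 1), X.gap i j ω

/-- If `c i` customers of each stream `i` have already arrived, the stream of the customer who
arrives next. (Simultaneous arrivals have probability zero and are ordered arbitrarily.) -/
noncomputable def nextStream (X : S.Input P) (c : S.Stream → ℕ) (ω : Ω) : S.Stream :=
  Classical.choose (Finite.exists_min fun i => X.arrivalTime i (c i) ω)

open Classical in
/-- How many of the first `n` customers of the whole system belong to each stream. -/
noncomputable def count (X : S.Input P) (ω : Ω) : ℕ → S.Stream → ℕ
  | 0 => fun _ => 0
  | n + 1 => fun i =>
      X.count ω n i + if i = X.nextStream (X.count ω n) ω then 1 else 0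

/-- The stream of the `n`-th customer (counted from `0`) in the superposition of all streams. -/
noncomputable def stream (X : S.Input P) (n : ℕ) (ω : Ω) : S.Stream :=
  X.nextStream (X.count ω n) ω

/-- The arrival time of the `n`-th customer of the whole system. -/
noncomputable def epoch (X : S.Input P) (n : ℕ) (ω : Ω) : ℝ :=
  X.arrivalTime (X.stream n ω) (X.count ω n (X.stream n ω)) ω

/-- The service time of the `n`-th customer of the whole system. -/
noncomputable def serviceTime (X : S.Input P) (n : ℕ) (ω : Ω) : ℝ :=
  X.service (X.stream n ω) (X.count ω n (X.stream n ω)) ω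

open Classical in
/-- The unfinished work of the server of regime `r` just before the arrival of the `n`-th customer
of the whole system. It jumps by the service time of each customer who joins the queue of `r`, and
decreases at unit speed between arrivals as long as it is positive. -/
noncomputable def workload (X : S.Input P) (ω : Ω) : ℕ → R → ℝ
  | 0 => fun r => max (X.init r ω - X.epoch 0 ω) 0
  | n + 1 => fun r =>
      max (X.workload ω n r + (if (X.stream n ω).regime = r then X.serviceTime n ω else 0)
        - (X.epoch (n + 1) ω - X.epoch n ω)) 0

/-- The sojourn time of the `n`-th customer of the whole system: under the first-come, first-served
discipline the customer waits until the work found in the queue of the assigned regime is finished,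
and is then served. -/
noncomputable def sojourn (X : S.Input P) (n : ℕ) (ω : Ω) : ℝ :=
  X.workload ω n (X.stream n ω).regime + X.serviceTime n ω

/-- The index, in the whole system, of the `n`-th customer originating at `a`. -/
noncomputable def indexFrom (X : S.Input P) (a : A) (n : ℕ) (ω : Ω) : ℕ :=
  Nat.nth (fun m => (X.stream m ω).origin = a) n

end Input

end ServiceSystem

/-- The hyperexponential distribution: the mixture with weights `w i` of exponential distributions
with rates `θ i`. -/
noncomputable def hyperexponential {ι : Type*} [Fintype ι] (w θ : ι → ℝ) : Measure ℝ :=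
  ∑ i, ENNReal.ofReal (w i) • expMeasure (θ i)

/-! ### Exponential laws -/

section Exponential

open scoped ENNReal

/-! Merge all streams into one Poisson process of rate `L = ∑ Λ_r` and look at each queue only
through the arrivals of this process. By memorylessness, the first gap, the mark (stream and service
time) of the first customer, and the streams as seen from this arrival are independent; the gap is
exponential of rate `L` and the future has the original law (`map_firstCustomer_shiftStreams`). So
the work in queue `r` just after arrivals follows a Lindley recursion `Y ↦ (Y - D)⁺ + B`, where `D`
is exponential of rate `L` and `B` is exponential of rate `μ_r` with probability `p = Λ_r / L`, and
zero otherwise.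

Its stationary law is explicit. With `θ = μ_r - Λ_r` and `ρ = Λ_r / μ_r`, the work found on arrival
is exponential of rate `θ` with probability `ρ` and zero otherwise; adding an independent service
time gives exactly the exponential law of rate `θ` (`expOrZero_conv_expMeasure`). The regime joined
is independent of the work found and equals `r` with probability `π_r`. The event that the sojourn
time lies in a set splits disjointly over the regimes, so the queues are treated one at a time,
their joint law is never needed, and the sum over `r` is the hyperexponential law.

For the customers of one demand point the index of observation is random. The routing hypothesis
says that belonging to this class does not change the chance of joining a given queue, hence `B` has
the same conditional law inside and outside the class. Each step then preserves the stationary law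
whichever class the customer belongs to, the state after `n` customers is independent of how many
belonged to the class (`exists_map_iterate_queueStep_restrict`), and the `n`-th member of the class
also sees the stationary law (`measure_iterate_queueStep_markIndex`). The class of all customers is
the case of the full set of streams.

The initial work is arbitrary and may depend on the input, so it is compared with a stationary copy
driven by the same path. Stability and the strong law force the larger workload to empty, after
which the two agree (`lindley_coupling`). The probabilities of all measurable sets therefore
converge (`tendsto_measure_sojournEvent`), which is more than convergence in distribution. -/

theorem expMeasure_Iic {r : ℝ} (hr : 0 < r) (x : ℝ) :
    expMeasure r (Set.Iic x) = ENNReal.ofReal (1 - Real.exp (-(r * max x 0))) := by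
  have := isProbabilityMeasure_expMeasure hr
  have h := cdf_expMeasure_eq hr x
  rw [cdf_eq_real, measureReal_def] at h
  rw [← ENNReal.ofReal_toReal (measure_ne_top (expMeasure r) (Set.Iic x)), h]
  split_ifs with hx
  · rw [max_eq_left hx]
  · rw [max_eq_right (not_le.1 hx).le]; simp

theorem expMeasure_Ioi {r : ℝ} (hr : 0 < r) (x : ℝ) :
    expMeasure r (Set.Ioi x) = ENNReal.ofReal (Real.exp (-(r * max x 0))) := by
  have := isProbabilityMeasure_expMeasure hr
  rw [← Set.compl_Iic, prob_compl_eq_one_sub measurableSet_Iic, expMeasure_Iic hr,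
    ← ENNReal.ofReal_one, ← ENNReal.ofReal_sub]
  · congr 1; ring
  · have : 0 ≤ r * max x 0 := mul_nonneg hr.le (le_max_right _ _)
    have := Real.exp_le_one_iff.2 (neg_nonpos.2 this)
    linarith

theorem expMeasure_noAtoms (r x : ℝ) : expMeasure r {x} = 0 := by
  rw [expMeasure, gammaMeasure]
  exact withDensity_absolutelyContinuous _ _ (measure_singleton x)

theorem expMeasure_Iio {r : ℝ} (hr : 0 < r) (x : ℝ) :
    expMeasure r (Set.Iio x) = ENNReal.ofReal (1 - Real.exp (-(r * max x 0))) := by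
  rw [← expMeasure_Iic hr, ← Set.Iio_union_right,
    measure_union (by simp) (measurableSet_singleton x), expMeasure_noAtoms, add_zero]

theorem ae_nonneg_expMeasure {r : ℝ} (hr : 0 < r) : ∀ᵐ x ∂expMeasure r, 0 ≤ x := by
  have h := expMeasure_Iio hr 0
  simp only [max_self, mul_zero, neg_zero, Real.exp_zero, sub_self, ENNReal.ofReal_zero] at h
  rw [ae_iff]
  convert h using 2
  ext x; simp

/-- Exponential tilting of an exponential law. -/
theorem lintegral_exp_mul_expMeasure {r c : ℝ} (hr : 0 < r) (hc : 0 < r + c) {f : ℝ → ℝ≥0∞}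
    (hf : Measurable f) :
    ∫⁻ x, ENNReal.ofReal (Real.exp (-(c * x))) * f x ∂expMeasure r =
      ENNReal.ofReal (r / (r + c)) * ∫⁻ x, f x ∂expMeasure (r + c) := by
  have hm : ∀ s : ℝ, Measurable (gammaPDF 1 s) := fun s =>
    (measurable_gammaPDFReal 1 s).ennreal_ofReal
  rw [expMeasure, expMeasure, gammaMeasure, gammaMeasure,
    lintegral_withDensity_eq_lintegral_mul _ (hm r) (by fun_prop),
    lintegral_withDensity_eq_lintegral_mul _ (hm (r + c)) hf,
    ← lintegral_const_mul _ ((hm (r + c)).mul hf)]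
  refine lintegral_congr fun x => ?_
  have h : gammaPDF 1 r x * ENNReal.ofReal (Real.exp (-(c * x))) =
      ENNReal.ofReal (r / (r + c)) * gammaPDF 1 (r + c) x := by
    change exponentialPDF r x * _ = _ * exponentialPDF (r + c) x
    rw [exponentialPDF_eq, exponentialPDF_eq]
    split_ifs with hx
    · rw [← ENNReal.ofReal_mul (by positivity), ← ENNReal.ofReal_mul (by positivity)]
      congr 1
      rw [mul_assoc, ← Real.exp_add]
      field_simp
      congr 1
      ring
    · simp
  simp only [Pi.mul_apply]
  rw [← mul_assoc, h, mul_assoc]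

theorem prob_ext_of_Ioi {μ ν : Measure ℝ} [IsProbabilityMeasure μ] [IsProbabilityMeasure ν]
    (h : ∀ x, μ (Set.Ioi x) = ν (Set.Ioi x)) : μ = ν := by
  refine Measure.ext_of_Iic μ ν fun x => ?_
  rw [← Set.compl_Ioi, prob_compl_eq_one_sub measurableSet_Ioi,
    prob_compl_eq_one_sub measurableSet_Ioi, h]

/-- The mixture of an atom at `0` of mass `1 - p` and an exponential law of rate `r` of mass `p`. -/
noncomputable def expOrZero (p r : ℝ) : Measure ℝ :=
  ENNReal.ofReal (1 - p) • Measure.dirac 0 + ENNReal.ofReal p • expMeasure r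

theorem isProbabilityMeasure_expOrZero {p r : ℝ} (hp : 0 ≤ p) (hp1 : p ≤ 1) (hr : 0 < r) :
    IsProbabilityMeasure (expOrZero p r) := by
  have := isProbabilityMeasure_expMeasure hr
  refine ⟨?_⟩
  simp only [expOrZero, Measure.add_apply, Measure.smul_apply, measure_univ, smul_eq_mul, mul_one]
  rw [← ENNReal.ofReal_add (by linarith) hp]
  simp

theorem expOrZero_Ioi {p r : ℝ} (hp : 0 ≤ p) (hr : 0 < r) {x : ℝ} (hx : 0 ≤ x) :
    expOrZero p r (Set.Ioi x) = ENNReal.ofReal (p * Real.exp (-(r * x))) := by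
  simp only [expOrZero, Measure.add_apply, Measure.smul_apply, smul_eq_mul, expMeasure_Ioi hr,
    max_eq_left hx]
  rw [Measure.dirac_apply' _ measurableSet_Ioi, ENNReal.ofReal_mul hp]
  simp [hx]

/-- Waiting time plus service time in the stationary M/M/1 queue. -/
theorem expOrZero_conv_expMeasure {μ θ : ℝ} (hθ : 0 < θ) (hμ : θ ≤ μ) :
    (expOrZero ((μ - θ) / μ) θ).conv (expMeasure μ) = expMeasure θ := by
  have hμ0 : 0 < μ := hθ.trans_le hμ
  have := isProbabilityMeasure_expMeasure hμ0
  have := isProbabilityMeasure_expMeasure hθ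
  have hp : 0 ≤ (μ - θ) / μ := div_nonneg (by linarith) hμ0.le
  have hp1 : (μ - θ) / μ ≤ 1 := by rw [div_le_one hμ0]; linarith
  have := isProbabilityMeasure_expOrZero hp hp1 hθ
  -- For `θ = μ` the weight of the exponential part vanishes. This case is separated because the
  -- tail formula below divides by `μ - θ`.
  rcases hμ.eq_or_lt with rfl | hlt
  · simp [expOrZero]
  refine prob_ext_of_Ioi fun t => ?_
  -- Condition on the service time `s`: beyond `max t 0` it suffices alone, and below it the
  -- remaining tail `exp (-θ (t - s))` is integrated by tilting the law of `s` by `-θ`. Writing `max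
  -- t 0` covers both signs of `t`.
  have key : ((expMeasure θ).conv (expMeasure μ)) (Set.Ioi t) =
      ENNReal.ofReal (Real.exp (-(μ * max t 0))) + ENNReal.ofReal
        (μ / (μ - θ) * (Real.exp (-(θ * max t 0)) - Real.exp (-(μ * max t 0)))) := by
    rw [Measure.conv_comm, Measure.conv, Measure.map_apply (by fun_prop) measurableSet_Ioi,
      Measure.prod_apply (measurableSet_Ioi.preimage (by fun_prop))]
    have h1 : ∀ s : ℝ, expMeasure θ (Prod.mk s ⁻¹' ((fun x : ℝ × ℝ => x.1 + x.2) ⁻¹' Set.Ioi t))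
        = ENNReal.ofReal (Real.exp (-(θ * max (t - s) 0))) := by
      intro s
      rw [← expMeasure_Ioi hθ]
      congr 1; ext x; simp [sub_lt_iff_lt_add']
    simp_rw [h1]
    rw [← lintegral_add_compl _ (measurableSet_Ioi (a := max t 0)), Set.compl_Ioi]
    congr 1
    · have e : ENNReal.ofReal (Real.exp (-(μ * max t 0))) = expMeasure μ (Set.Ioi (max t 0)) := by
        rw [expMeasure_Ioi hμ0, max_eq_left (le_max_right t 0)]
      rw [e, ← lintegral_indicator_one measurableSet_Ioi, ← lintegral_indicator measurableSet_Ioi]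
      refine lintegral_congr fun s => ?_
      by_cases hs : s ∈ Set.Ioi (max t 0)
      · simp only [Set.indicator_of_mem hs, Pi.one_apply]
        have : t - s ≤ 0 := by
          have := lt_of_le_of_lt (le_max_left t 0) hs
          linarith
        simp [max_eq_right this]
      · simp only [Set.indicator_of_notMem hs]
    · have h2 : ∀ᵐ s ∂(expMeasure μ), (Set.Iic (max t 0)).indicator
          (fun s => ENNReal.ofReal (Real.exp (-(θ * max (t - s) 0)))) s =
          ENNReal.ofReal (Real.exp (-((-θ) * s))) * ((Set.Iic (max t 0)).indicator
            (fun _ => ENNReal.ofReal (Real.exp (-(θ * max t 0)))) s) := by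
        filter_upwards [ae_nonneg_expMeasure hμ0] with s hs
        by_cases h : s ∈ Set.Iic (max t 0)
        · simp only [Set.indicator_of_mem h]
          rw [← ENNReal.ofReal_mul (by positivity), ← Real.exp_add]
          congr 2
          have h' : s ≤ max t 0 := h
          rcases le_total t 0 with ht | ht
          · rw [max_eq_right ht] at h'
            have : s = 0 := le_antisymm h' hs
            subst this; simp
          · rw [max_eq_left ht] at h' ⊢
            rw [max_eq_left (by linarith)]; ring
        · simp only [Set.indicator_of_notMem h, mul_zero]
      rw [← lintegral_indicator measurableSet_Iic, lintegral_congr_ae h2,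
        lintegral_exp_mul_expMeasure hμ0 (by linarith) (measurable_const.indicator measurableSet_Iic),
        lintegral_indicator_const measurableSet_Iic, ← sub_eq_add_neg,
        expMeasure_Iic (by linarith), ← ENNReal.ofReal_mul (by positivity),
        ← ENNReal.ofReal_mul (div_nonneg hμ0.le (by linarith)), max_eq_left (le_max_right t 0)]
      congr 2
      rw [mul_sub, mul_one, ← Real.exp_add]
      congr 2
      ring
  have hsub : 0 < μ - θ := by linarith
  have hexp : Real.exp (-(μ * max t 0)) ≤ Real.exp (-(θ * max t 0)) := by
    have := le_max_right t 0
    gcongr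
  have hp1' : 0 ≤ 1 - (μ - θ) / μ := by linarith
  rw [expOrZero, Measure.add_conv, Measure.conv_smul_left, Measure.conv_smul_left,
    Measure.dirac_zero_conv]
  simp only [Measure.add_apply, Measure.smul_apply, smul_eq_mul]
  rw [key, expMeasure_Ioi hμ0, expMeasure_Ioi hθ, ← ENNReal.ofReal_add (Real.exp_pos _).le,
    ← ENNReal.ofReal_mul hp, ← ENNReal.ofReal_mul hp1', ← ENNReal.ofReal_add]
  · congr 1
    field_simp
    ring
  · exact mul_nonneg hp1' (Real.exp_pos _).le
  · refine mul_nonneg hp (add_nonneg (Real.exp_pos _).le (mul_nonneg ?_ ?_))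
    · positivity
    · linarith
  · refine mul_nonneg ?_ ?_
    · positivity
    · linarith

/-- The law of `(X - D)⁺` for independent `X` (zero or exponential) and exponential `D`. -/
theorem map_max_sub_expOrZero_prod {β θ l : ℝ} (hβ : 0 ≤ β) (hβ1 : β ≤ 1) (hθ : 0 < θ)
    (hl : 0 < l) :
    ((expOrZero β θ).prod (expMeasure l)).map (fun p => max (p.1 - p.2) 0) =
      expOrZero (β * l / (l + θ)) θ := by
  have := isProbabilityMeasure_expMeasure hl
  have := isProbabilityMeasure_expOrZero hβ hβ1 hθ
  have hq : 0 ≤ β * l / (l + θ) := by positivity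
  have hq1 : β * l / (l + θ) ≤ 1 := by
    rw [div_le_one (by positivity)]; nlinarith
  have := isProbabilityMeasure_expOrZero hq hq1 hθ
  have hm : Measurable (fun p : ℝ × ℝ => max (p.1 - p.2) 0) := by fun_prop
  have := Measure.isProbabilityMeasure_map (μ := (expOrZero β θ).prod (expMeasure l))
    hm.aemeasurable
  refine prob_ext_of_Ioi fun t => ?_
  rcases lt_or_ge t 0 with ht | ht
  · have h1 : (fun p : ℝ × ℝ => max (p.1 - p.2) 0) ⁻¹' Set.Ioi t = Set.univ := by
      ext p; simp [ht]
    have h2 : (expOrZero (β * l / (l + θ)) θ) (Set.Ioi t) = 1 := by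
      simp only [expOrZero, Measure.add_apply, Measure.smul_apply, smul_eq_mul, expMeasure_Ioi hθ,
        max_eq_right ht.le]
      rw [Measure.dirac_apply' _ measurableSet_Ioi]
      simp only [Set.mem_Ioi, ht, Set.indicator_of_mem, Pi.one_apply, mul_one, mul_zero, neg_zero,
        Real.exp_zero, ENNReal.ofReal_one]
      rw [← ENNReal.ofReal_add (by linarith) hq]; simp
    rw [Measure.map_apply hm measurableSet_Ioi, h1, h2, measure_univ]
  · rw [expOrZero_Ioi hq hθ ht, Measure.map_apply hm measurableSet_Ioi,
      Measure.prod_apply_symm (hm measurableSet_Ioi)]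
    -- The tail at `t + d` factors into a function of `t` and `exp (-θ d)`. The mean of the latter
    -- is `l / (l + θ)`, the factor by which the weight drops.
    have h1 : ∀ᵐ d ∂(expMeasure l), expOrZero β θ
        ((fun x => (x, d)) ⁻¹' ((fun p : ℝ × ℝ => max (p.1 - p.2) 0) ⁻¹' Set.Ioi t)) =
        ENNReal.ofReal (Real.exp (-(θ * d))) * ENNReal.ofReal (β * Real.exp (-(θ * t))) := by
      filter_upwards [ae_nonneg_expMeasure hl] with d hd
      have : (fun x => (x, d)) ⁻¹' ((fun p : ℝ × ℝ => max (p.1 - p.2) 0) ⁻¹' Set.Ioi t) =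
          Set.Ioi (t + d) := by
        ext x; simp [not_lt.2 ht, lt_sub_iff_add_lt]
      rw [this, expOrZero_Ioi hβ hθ (by linarith), ← ENNReal.ofReal_mul (by positivity)]
      congr 1
      rw [mul_left_comm, ← Real.exp_add]
      congr 2; ring
    have := isProbabilityMeasure_expMeasure (r := l + θ) (by positivity)
    rw [lintegral_congr_ae h1, lintegral_exp_mul_expMeasure hl (by linarith) measurable_const,
      lintegral_const, measure_univ, mul_one, ← ENNReal.ofReal_mul (by positivity)]
    congr 1
    ring

/-- With probability `1 - p` no work is added; with probability `p` a full service time is added,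
and the total becomes exponential of rate `θ` by the preceding convolution identity. -/
theorem expOrZero_conv_expOrZero {p μ θ : ℝ} (hp : 0 ≤ p) (hp1 : p ≤ 1) (hθ : 0 < θ)
    (hμ : θ ≤ μ) :
    (expOrZero ((μ - θ) / μ) θ).conv (expOrZero p μ) =
      expOrZero ((1 - p) * ((μ - θ) / μ) + p) θ := by
  have hμ0 : 0 < μ := hθ.trans_le hμ
  have := isProbabilityMeasure_expMeasure hμ0
  have := isProbabilityMeasure_expMeasure hθ
  have hr : 0 ≤ (μ - θ) / μ := div_nonneg (by linarith) hμ0.le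
  have hr1 : (μ - θ) / μ ≤ 1 := by rw [div_le_one hμ0]; linarith
  have := isProbabilityMeasure_expOrZero hr hr1 hθ
  have := isProbabilityMeasure_expOrZero hp hp1 hμ0
  rw [Measure.conv_comm]
  conv_lhs => rw [expOrZero]
  rw [Measure.add_conv, Measure.conv_smul_left, Measure.conv_smul_left, Measure.dirac_zero_conv,
    Measure.conv_comm, expOrZero_conv_expMeasure hθ hμ]
  simp only [expOrZero]
  rw [smul_add, smul_smul, smul_smul, add_assoc, ← add_smul,
    ← ENNReal.ofReal_mul (by linarith), ← ENNReal.ofReal_mul (by linarith), ← ENNReal.ofReal_add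
      (mul_nonneg (by linarith) hr) hp]
  congr 3
  ring

/-- `x` times the exponential density is `1 / r` times the Gamma density of shape `2`, which has
mass one. -/
theorem lintegral_ofReal_id_expMeasure {r : ℝ} (hr : 0 < r) :
    ∫⁻ x, ENNReal.ofReal x ∂expMeasure r = ENNReal.ofReal (1 / r) := by
  have hm : ∀ a : ℝ, Measurable (gammaPDF a r) := fun a =>
    (measurable_gammaPDFReal a r).ennreal_ofReal
  rw [expMeasure, gammaMeasure, lintegral_withDensity_eq_lintegral_mul _ (hm 1) (by fun_prop),
    ← mul_one (ENNReal.ofReal (1 / r)), ← lintegral_gammaPDF_eq_one two_pos hr,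
    ← lintegral_const_mul _ (hm 2)]
  refine lintegral_congr fun x => ?_
  simp only [Pi.mul_apply, gammaPDF, gammaPDFReal]
  split_ifs with hx
  · rw [← ENNReal.ofReal_mul (by simp; positivity), ← ENNReal.ofReal_mul (by positivity)]
    congr 1
    have : Real.Gamma 2 = 1 := Real.Gamma_two
    rw [this, Real.Gamma_one]
    norm_num
    field_simp
  · simp

theorem integrable_id_expMeasure {r : ℝ} (hr : 0 < r) :
    Integrable (fun x : ℝ => x) (expMeasure r) := by
  refine ⟨by fun_prop, ?_⟩
  rw [hasFiniteIntegral_iff_ofReal (ae_nonneg_expMeasure hr), lintegral_ofReal_id_expMeasure hr]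
  exact ENNReal.ofReal_lt_top

theorem integral_id_expMeasure {r : ℝ} (hr : 0 < r) : ∫ x, x ∂expMeasure r = 1 / r := by
  rw [integral_eq_lintegral_of_nonneg_ae (ae_nonneg_expMeasure hr) (by fun_prop),
    lintegral_ofReal_id_expMeasure hr, ENNReal.toReal_ofReal (by positivity)]

end Exponential

/-! ### Sequences of independent variables -/

section Sequences

open scoped ENNReal

variable {α : Type*}

/-- The sequence `z, s 0, s 1, …`. -/
def seqCons (z : α) (s : ℕ → α) : ℕ → α
  | 0 => z
  | k + 1 => s k

variable [MeasurableSpace α]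

theorem measurable_seqCons : Measurable fun p : α × (ℕ → α) => seqCons p.1 p.2 := by
  refine measurable_pi_lambda _ fun k => ?_
  cases k with
  | zero => exact measurable_fst
  | succ k => exact (measurable_pi_apply k).comp measurable_snd

theorem map_seqCons_infinitePi (ρ : Measure α) [IsProbabilityMeasure ρ] :
    (ρ.prod (Measure.infinitePi fun _ : ℕ => ρ)).map (fun p => seqCons p.1 p.2) =
      Measure.infinitePi fun _ : ℕ => ρ := by
  classical
  refine Measure.eq_infinitePi _ fun F t ht => ?_
  obtain ⟨n, hn⟩ : ∃ n, F ⊆ Finset.range (n + 1) := by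
    obtain ⟨n, hn⟩ := F.exists_nat_subset_range
    exact ⟨n, hn.trans (Finset.range_mono n.le_succ)⟩
  -- Padding with the whole space turns a box over `F` into one over an initial segment, from which
  -- coordinate `0` can be split off.
  set u : ℕ → Set α := fun k => if k ∈ F then t k else Set.univ with hu
  have hum : ∀ k, MeasurableSet (u k) := fun k => by
    simp only [hu]; split_ifs; exacts [ht k, .univ]
  have h1 : Set.pi (F : Set ℕ) t = Set.pi (Finset.range (n + 1) : Set ℕ) u := by
    ext x
    simp only [Set.mem_pi, hu, Finset.mem_coe]
    refine ⟨fun h k _ => ?_, fun h k hk => ?_⟩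
    · split_ifs with hk
      exacts [h k hk, trivial]
    · simpa [hk] using h k (hn hk)
  have h2 : ∏ i ∈ F, ρ (t i) = ∏ i ∈ Finset.range (n + 1), ρ (u i) := by
    rw [← Finset.prod_subset hn]
    · exact Finset.prod_congr rfl fun i hi => by simp [hu, hi]
    · intro i _ hi; simp [hu, hi]
  have h3 : (fun p : α × (ℕ → α) => seqCons p.1 p.2) ⁻¹'
      Set.pi (Finset.range (n + 1) : Set ℕ) u =
      u 0 ×ˢ Set.pi (Finset.range n : Set ℕ) fun k => u (k + 1) := by
    ext ⟨z, s⟩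
    simp only [Set.mem_preimage, Set.mem_pi, Finset.coe_range, Set.mem_Iio, Set.mem_prod]
    refine ⟨fun h => ⟨h 0 (by omega), fun k hk => h (k + 1) (by omega)⟩, fun h k hk => ?_⟩
    cases k with
    | zero => exact h.1
    | succ k => exact h.2 k (by omega)
  rw [h1, h2, Measure.map_apply measurable_seqCons
    (.pi (Finset.countable_toSet _) fun i _ => hum i), h3, Measure.prod_prod,
    Measure.infinitePi_pi _ fun i _ => hum (i + 1), Finset.prod_range_succ', mul_comm]

theorem lintegral_infinitePi_seqCons (ρ : Measure α) [IsProbabilityMeasure ρ]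
    {f : (ℕ → α) → ℝ≥0∞} (hf : Measurable f) :
    ∫⁻ s, f s ∂(Measure.infinitePi fun _ : ℕ => ρ) =
      ∫⁻ z, ∫⁻ s, f (seqCons z s) ∂(Measure.infinitePi fun _ : ℕ => ρ) ∂ρ := by
  conv_lhs => rw [← map_seqCons_infinitePi ρ]
  rw [lintegral_map hf measurable_seqCons]
  exact lintegral_prod _ (hf.comp measurable_seqCons).aemeasurable

/-- Resampling one coordinate of a product measure. -/
theorem map_update_pi {ι : Type*} [Fintype ι] [DecidableEq ι] (m : ι → Measure α)
    [∀ i, IsProbabilityMeasure (m i)] (i : ι) :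
    ((Measure.pi m).prod (m i)).map (fun p => Function.update p.1 i p.2) = Measure.pi m := by
  have hmeas : Measurable fun p : (ι → α) × α => Function.update p.1 i p.2 := by fun_prop
  refine (Measure.pi_eq fun t ht => ?_).symm
  have h : (fun p : (ι → α) × α => Function.update p.1 i p.2) ⁻¹' Set.univ.pi t =
      (Set.univ.pi (Function.update t i Set.univ)) ×ˢ t i := by
    ext ⟨x, y⟩
    simp only [Set.mem_preimage, Set.mem_pi, Set.mem_univ, true_imp_iff, Set.mem_prod]
    refine ⟨fun hx => ⟨fun j => ?_, by simpa using hx i⟩, fun hx j => ?_⟩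
    · rcases eq_or_ne j i with rfl | hj
      · simp
      · simpa [hj] using hx j
    · rcases eq_or_ne j i with rfl | hj
      · simpa using hx.2
      · simpa [hj] using hx.1 j
  rw [Measure.map_apply hmeas (.univ_pi ht), h, Measure.prod_prod, Measure.pi_pi,
    ← Finset.prod_erase_mul _ _ (Finset.mem_univ i), ← Finset.prod_erase_mul _ _
      (Finset.mem_univ i), Function.update_self, measure_univ, mul_one]
  congr 1
  refine Finset.prod_congr rfl fun j hj => ?_
  rw [Function.update_of_ne (Finset.ne_of_mem_erase hj)]

theorem lintegral_pi_update {ι : Type*} [Fintype ι] [DecidableEq ι] (m : ι → Measure α)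
    [∀ i, IsProbabilityMeasure (m i)] (i : ι) {f : (ι → α) → ℝ≥0∞} (hf : Measurable f) :
    ∫⁻ x, f x ∂Measure.pi m = ∫⁻ y, ∫⁻ x, f (Function.update x i y) ∂Measure.pi m ∂m i := by
  have hmeas : Measurable fun p : (ι → α) × α => Function.update p.1 i p.2 := by fun_prop
  conv_lhs => rw [← map_update_pi m i]
  rw [lintegral_map hf hmeas]
  exact lintegral_prod_symm _ (hf.comp hmeas).aemeasurable

/-- Collects the survival probabilities of the separate streams into one factor. -/
theorem pi_smul_measure {ι : Type*} [Fintype ι] (m : ι → Measure α)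
    [∀ i, IsProbabilityMeasure (m i)] (c : ι → ℝ≥0∞) (hc : ∀ i, c i ≠ ∞) :
    Measure.pi (fun i => c i • m i) = (∏ i, c i) • Measure.pi m := by
  have : ∀ i, IsFiniteMeasure (c i • m i) := fun i => Measure.smul_finite _ (hc i)
  refine Measure.pi_eq fun t ht => ?_
  simp [Finset.prod_mul_distrib]

end Sequences

/-! ### Superposition of Poisson streams with marks -/

section Superposition

open scoped ENNReal

/-- The residual gaps after time `d` of a marked stream whose first point is later than `d`. -/
def residualSeq (d : ℝ) (s : ℕ → ℝ × ℝ) : ℕ → ℝ × ℝ :=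
  seqCons ((s 0).1 - d, (s 0).2) fun k => s (k + 1)

theorem measurable_residualSeq :
    Measurable fun p : ℝ × (ℕ → ℝ × ℝ) => residualSeq p.1 p.2 := by
  have : Measurable fun p : ℝ × (ℕ → ℝ × ℝ) =>
      ((((p.2 0).1 - p.1, (p.2 0).2), fun k => p.2 (k + 1)) : (ℝ × ℝ) × (ℕ → ℝ × ℝ)) := by
    fun_prop
  exact measurable_seqCons.comp this

/-- The law of the sequence of (gap, mark) pairs of a Poisson stream with i.i.d. marks. -/
noncomputable def markedStreamLaw (l : ℝ) (m : Measure ℝ) : Measure (ℕ → ℝ × ℝ) :=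
  Measure.infinitePi fun _ : ℕ => (expMeasure l).prod m

/-- Memorylessness in integral form, by the substitution `x ↦ x + d` in the density. -/
theorem lintegral_expMeasure_memoryless {l d : ℝ} (hd : 0 ≤ d) {f : ℝ → ℝ≥0∞}
    (hf : Measurable f) :
    ∫⁻ x, (Set.Ioi d).indicator (fun x => f (x - d)) x ∂expMeasure l =
      ENNReal.ofReal (Real.exp (-(l * d))) * ∫⁻ x, f x ∂expMeasure l := by
  have hm : Measurable (gammaPDF 1 l) := (measurable_gammaPDFReal 1 l).ennreal_ofReal
  have hg : Measurable fun x => (Set.Ioi d).indicator (fun x => f (x - d)) x :=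
    (hf.comp (by fun_prop)).indicator measurableSet_Ioi
  rw [expMeasure, gammaMeasure, lintegral_withDensity_eq_lintegral_mul _ hm hg,
    lintegral_withDensity_eq_lintegral_mul _ hm hf, ← lintegral_const_mul _ (hm.mul hf),
    ← lintegral_add_right_eq_self _ d]
  refine lintegral_congr_ae ?_
  -- At `x = 0` the two integrands may differ: the exponential density is positive there, while
  -- `Set.Ioi d` excludes `d`.
  filter_upwards [Measure.ae_ne volume (0 : ℝ)] with x hx
  simp only [Pi.mul_apply]
  change exponentialPDF l (x + d) * _ = _ * (exponentialPDF l x * _)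
  rw [exponentialPDF_eq, exponentialPDF_eq]
  rcases lt_or_gt_of_ne hx with hx | hx
  · rw [Set.indicator_of_notMem (by simp [hx.le]), if_neg (not_le.2 hx)]; simp
  · rw [Set.indicator_of_mem (by simp [hx]), if_pos hx.le, if_pos (by linarith), ← mul_assoc,
      ← ENNReal.ofReal_mul (by positivity), add_sub_cancel_right]
    congr 2
    rw [mul_left_comm, ← Real.exp_add]
    congr 2; ring

/-- Only the first gap is shortened; its mark and all later pairs are independent of it, so the
scalar memoryless property applies after splitting off the first pair. -/
theorem map_residualSeq_restrict {l d : ℝ} (hl : 0 < l) (hd : 0 ≤ d) (m : Measure ℝ)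
    [IsProbabilityMeasure m] :
    ((markedStreamLaw l m).restrict {s | d < (s 0).1}).map (residualSeq d) =
      ENNReal.ofReal (Real.exp (-(l * d))) • markedStreamLaw l m := by
  have := isProbabilityMeasure_expMeasure hl
  have hr : Measurable (residualSeq d) := measurable_residualSeq.comp measurable_prodMk_left
  have hS : MeasurableSet {s : ℕ → ℝ × ℝ | d < (s 0).1} :=
    measurableSet_lt measurable_const (by fun_prop)
  have hfr : ∀ f : (ℕ → ℝ × ℝ) → ℝ≥0∞, Measurable f → Measurable
      ({s : ℕ → ℝ × ℝ | d < (s 0).1}.indicator fun s => f (residualSeq d s)) :=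
    fun f hf => (hf.comp hr).indicator hS
  refine Measure.ext_of_lintegral _ fun f hf => ?_
  have hfc : Measurable fun z : ℝ × ℝ => ∫⁻ s, f (seqCons z s) ∂markedStreamLaw l m := by
    unfold markedStreamLaw
    exact (hf.comp measurable_seqCons).lintegral_prod_right'
  rw [lintegral_map hf hr, lintegral_smul_measure, ← lintegral_indicator hS]
  unfold markedStreamLaw at hfc ⊢
  rw [lintegral_infinitePi_seqCons _ (hfr f hf),
    lintegral_infinitePi_seqCons _ hf]
  have h1 : ∀ z : ℝ × ℝ, ∫⁻ s, {s : ℕ → ℝ × ℝ | d < (s 0).1}.indicator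
      (fun s => f (residualSeq d s)) (seqCons z s)
        ∂(Measure.infinitePi fun _ : ℕ => (expMeasure l).prod m) =
      (Set.Ioi d).indicator (fun x => ∫⁻ s, f (seqCons (x - d, z.2) s)
        ∂(Measure.infinitePi fun _ : ℕ => (expMeasure l).prod m)) z.1 := by
    intro z
    by_cases hz : d < z.1
    · rw [Set.indicator_of_mem (Set.mem_Ioi.2 hz)]
      refine lintegral_congr fun s => ?_
      rw [Set.indicator_of_mem (by exact hz)]
      rfl
    · rw [Set.indicator_of_notMem (by simpa using hz), ← lintegral_zero (α := ℕ → ℝ × ℝ)]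
      refine lintegral_congr fun s => ?_
      rw [Set.indicator_of_notMem (by exact hz)]
  have h2 : Measurable fun z : ℝ × ℝ => (Set.Ioi d).indicator
      (fun x => ∫⁻ s, f (seqCons (x - d, z.2) s)
        ∂(Measure.infinitePi fun _ : ℕ => (expMeasure l).prod m)) z.1 := by
    have : Measurable ((Prod.fst ⁻¹' Set.Ioi d : Set (ℝ × ℝ)).indicator
      fun z : ℝ × ℝ => ∫⁻ s, f (seqCons (z.1 - d, z.2) s)
        ∂(Measure.infinitePi fun _ : ℕ => (expMeasure l).prod m)) :=
      Measurable.indicator (hfc.comp (by fun_prop)) (measurable_fst measurableSet_Ioi)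
    exact this
  rw [lintegral_congr h1, lintegral_prod_symm _ h2.aemeasurable,
    lintegral_prod_symm _ hfc.aemeasurable, smul_eq_mul,
    ← lintegral_const_mul _ hfc.lintegral_prod_left']
  refine lintegral_congr fun y => ?_
  exact lintegral_expMeasure_memoryless hd (f := fun x => ∫⁻ s, f (seqCons (x, y) s)
        ∂(Measure.infinitePi fun _ : ℕ => (expMeasure l).prod m)) (hfc.comp (by fun_prop))

end Superposition

/-! ### The first customer of finitely many marked streams -/

section Superposition

open scoped ENNReal

variable {ι : Type*} [Fintype ι] [Nonempty ι]

/-- An index at which a finite family of reals is minimal. -/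
noncomputable def argmin (f : ι → ℝ) : ι := Classical.choose (Finite.exists_min f)

theorem argmin_le (f : ι → ℝ) (j : ι) : f (argmin f) ≤ f j :=
  Classical.choose_spec (Finite.exists_min f) j

/-- The choice depends only on the predicate of being a minimiser, which a shift leaves unchanged;
thus ties are also broken in the same way. -/
theorem argmin_sub_const (f : ι → ℝ) (c : ℝ) : argmin (fun i => f i - c) = argmin f := by
  unfold argmin
  congr 1
  ext i
  simp

theorem argmin_eq_of_forall_lt {f : ι → ℝ} {i : ι} (h : ∀ j, j ≠ i → f i < f j) :
    argmin f = i := by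
  by_contra hne
  exact absurd (argmin_le f i) (not_le.2 (h _ hne))

/-- The choice factors through the set of minimisers, which takes finitely many values and depends
measurably on `f`. -/
theorem measurable_argmin [MeasurableSpace ι] [DiscreteMeasurableSpace ι] :
    Measurable (argmin : (ι → ℝ) → ι) := by
  classical
  let g : (ι → Prop) → ι := fun p => if h : ∃ i, p i then Classical.choose h
    else Classical.arbitrary ι
  have hM : Measurable fun f : ι → ℝ => fun i => ∀ j, f i ≤ f j := by
    refine measurable_pi_lambda _ fun i => ?_
    refine measurableSet_setOfPred.1 ?_
    have : {f : ι → ℝ | ∀ j, f i ≤ f j} = ⋂ j, {f : ι → ℝ | f i ≤ f j} := by ext; simp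
    rw [this]
    exact MeasurableSet.iInter fun j => measurableSet_le (by fun_prop) (by fun_prop)
  have hg : Measurable g := measurable_of_finite g
  have : (argmin : (ι → ℝ) → ι) = g ∘ fun f : ι → ℝ => fun i => ∀ j, f i ≤ f j := by
    funext f
    have h := Finite.exists_min f
    simp only [Function.comp, g, dif_pos h]
    rfl
  rw [this]
  exact hg.comp hM

/-- The stream of the first customer. -/
noncomputable def firstStream (x : ι → ℕ → ℝ × ℝ) : ι := argmin fun i => (x i 0).1

/-- The arrival time, the stream and the service time of the first customer. -/
noncomputable def firstCustomer (x : ι → ℕ → ℝ × ℝ) : ℝ × ι × ℝ :=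
  ((x (firstStream x) 0).1, firstStream x, (x (firstStream x) 0).2)

open Classical in
/-- What remains of the streams after the arrival of a customer of stream `i` at time `d`. -/
noncomputable def removeFirst (i : ι) (d : ℝ) (x : ι → ℕ → ℝ × ℝ) : ι → ℕ → ℝ × ℝ :=
  fun j => if j = i then fun k => x j (k + 1) else residualSeq d (x j)

/-- The streams as seen from the arrival of the first customer on. -/
noncomputable def shiftStreams (x : ι → ℕ → ℝ × ℝ) : ι → ℕ → ℝ × ℝ :=
  removeFirst (firstStream x) (x (firstStream x) 0).1 x

omit [Fintype ι] [Nonempty ι] in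
theorem measurable_removeFirst (i : ι) :
    Measurable fun p : ℝ × (ι → ℕ → ℝ × ℝ) => removeFirst i p.1 p.2 := by
  refine measurable_pi_lambda _ fun j => ?_
  by_cases h : j = i
  · simp only [removeFirst, if_pos h]; fun_prop
  · simp only [removeFirst, if_neg h]
    have : Measurable fun p : ℝ × (ι → ℕ → ℝ × ℝ) => (p.1, p.2 j) := by fun_prop
    exact measurable_residualSeq.comp this

variable [MeasurableSpace ι] [DiscreteMeasurableSpace ι]

theorem measurable_firstStream : Measurable (firstStream : (ι → ℕ → ℝ × ℝ) → ι) := by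
  have : Measurable fun x : ι → ℕ → ℝ × ℝ => fun i => (x i 0).1 := by fun_prop
  exact measurable_argmin.comp this

theorem measurable_eval_firstStream :
    Measurable fun x : ι → ℕ → ℝ × ℝ => x (firstStream x) 0 := by
  have h : Measurable fun p : ι × (ι → ℕ → ℝ × ℝ) => p.2 p.1 0 :=
    measurable_from_prod_countable_right fun i => by dsimp only; fun_prop
  exact h.comp (measurable_firstStream.prodMk measurable_id)

theorem measurable_firstCustomer :
    Measurable (firstCustomer : (ι → ℕ → ℝ × ℝ) → ℝ × ι × ℝ) :=
  measurable_eval_firstStream.fst.prodMk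
    (measurable_firstStream.prodMk measurable_eval_firstStream.snd)

theorem measurable_shiftStreams :
    Measurable (shiftStreams : (ι → ℕ → ℝ × ℝ) → ι → ℕ → ℝ × ℝ) := by
  have h : Measurable fun p : ι × (ℝ × (ι → ℕ → ℝ × ℝ)) => removeFirst p.1 p.2.1 p.2.2 :=
    measurable_from_prod_countable_right fun i => measurable_removeFirst i
  exact h.comp (measurable_firstStream.prodMk
    (measurable_eval_firstStream.fst.prodMk measurable_id))

/-- The joint law of independent marked Poisson streams of rates `l i` and mark laws `m i`. -/
noncomputable def streamsLaw (l : ι → ℝ) (m : ι → Measure ℝ) : Measure (ι → ℕ → ℝ × ℝ) :=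
  Measure.pi fun i => markedStreamLaw (l i) (m i)

/-- The law of the stream and of the mark of a customer of the superposition. -/
noncomputable def customerLaw (l : ι → ℝ) (m : ι → Measure ℝ) : Measure (ι × ℝ) :=
  ∑ i, ENNReal.ofReal (l i / ∑ j, l j) • (m i).map (Prod.mk i)

section

variable {l : ι → ℝ} {m : ι → Measure ℝ} [∀ i, IsProbabilityMeasure (m i)]

theorem isProbabilityMeasure_markedStreamLaw {l : ℝ} (hl : 0 < l) (m : Measure ℝ)
    [IsProbabilityMeasure m] : IsProbabilityMeasure (markedStreamLaw l m) := by
  have := isProbabilityMeasure_expMeasure hl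
  unfold markedStreamLaw; infer_instance

omit [Nonempty ι] [MeasurableSpace ι] [DiscreteMeasurableSpace ι] in
theorem isProbabilityMeasure_streamsLaw (hl : ∀ i, 0 < l i) :
    IsProbabilityMeasure (streamsLaw l m) := by
  have := fun i => isProbabilityMeasure_markedStreamLaw (hl i) (m i)
  unfold streamsLaw; infer_instance

omit [MeasurableSpace ι] [DiscreteMeasurableSpace ι] in
theorem sum_rate_pos (hl : ∀ i, 0 < l i) : 0 < ∑ i, l i :=
  Finset.sum_pos (fun i _ => hl i) Finset.univ_nonempty

omit [MeasurableSpace ι] [DiscreteMeasurableSpace ι] in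
theorem sum_ofReal_rate_div (hl : ∀ i, 0 < l i) :
    ∑ i, ENNReal.ofReal (l i / ∑ j, l j) = 1 := by
  have h := sum_rate_pos hl
  rw [← ENNReal.ofReal_sum_of_nonneg fun i _ => div_nonneg (hl i).le h.le, ← Finset.sum_div,
    div_self h.ne', ENNReal.ofReal_one]

omit [DiscreteMeasurableSpace ι] in
theorem isProbabilityMeasure_customerLaw (hl : ∀ i, 0 < l i) :
    IsProbabilityMeasure (customerLaw l m) := by
  refine ⟨?_⟩
  simp only [customerLaw, Measure.finsetSum_apply, Measure.smul_apply, smul_eq_mul]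
  rw [← sum_ofReal_rate_div hl]
  refine Finset.sum_congr rfl fun i _ => ?_
  rw [Measure.map_apply (by fun_prop) .univ, Set.preimage_univ, measure_univ, mul_one]

omit [Nonempty ι] [DiscreteMeasurableSpace ι] [∀ i, IsProbabilityMeasure (m i)] in
theorem lintegral_customerLaw {f : ι × ℝ → ℝ≥0∞} (hf : Measurable f) :
    ∫⁻ p, f p ∂customerLaw l m =
      ∑ i, ENNReal.ofReal (l i / ∑ j, l j) * ∫⁻ s, f (i, s) ∂m i := by
  rw [customerLaw, lintegral_finsetSum_measure]
  refine Finset.sum_congr rfl fun i _ => ?_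
  rw [lintegral_smul_measure, lintegral_map hf (by fun_prop), smul_eq_mul]

omit [Nonempty ι] [MeasurableSpace ι] [DiscreteMeasurableSpace ι] in
open Classical in
/-- At a fixed time `d` before the first point of each stream `j ≠ i`, these streams are again
independent Poisson streams. -/
theorem lintegral_residual_streamsLaw (hl : ∀ i, 0 < l i) (i : ι) {d : ℝ} (hd : 0 ≤ d)
    {f : (ι → ℕ → ℝ × ℝ) → ℝ≥0∞} (hf : Measurable f) :
    ∫⁻ x, {x : ι → ℕ → ℝ × ℝ | ∀ j, j ≠ i → d < (x j 0).1}.indicator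
      (fun x => f fun j => if j = i then x j else residualSeq d (x j)) x ∂streamsLaw l m =
    ENNReal.ofReal (Real.exp (-((∑ j, l j - l i) * d))) * ∫⁻ x, f x ∂streamsLaw l m := by
  have hprob := fun i => isProbabilityMeasure_markedStreamLaw (hl i) (m i)
  -- Stream `i` is left untouched and contributes the factor `1`; each other stream contributes its
  -- probability `exp (-l j d)` of no point up to `d`.
  let A : ι → Set (ℕ → ℝ × ℝ) := fun j => if j = i then Set.univ else {s | d < (s 0).1}
  let g : ι → (ℕ → ℝ × ℝ) → ℕ → ℝ × ℝ := fun j => if j = i then id else residualSeq d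
  let c : ι → ℝ≥0∞ := fun j => if j = i then 1 else ENNReal.ofReal (Real.exp (-(l j * d)))
  have hA : ∀ j, MeasurableSet (A j) := fun j => by
    simp only [A]
    split_ifs
    exacts [.univ, measurableSet_lt measurable_const (by fun_prop)]
  have hg : ∀ j, Measurable (g j) := fun j => by
    simp only [g]
    split_ifs
    exacts [measurable_id, measurable_residualSeq.comp measurable_prodMk_left]
  have hc : ∀ j, c j ≠ ∞ := fun j => by
    simp only [c]; split_ifs
    exacts [ENNReal.one_ne_top, ENNReal.ofReal_ne_top]
  have hmap : ∀ j, ((markedStreamLaw (l j) (m j)).restrict (A j)).map (g j) =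
      c j • markedStreamLaw (l j) (m j) := fun j => by
    simp only [A, g, c]
    split_ifs
    · simp
    · exact map_residualSeq_restrict (hl j) hd (m j)
  have hset : {x : ι → ℕ → ℝ × ℝ | ∀ j, j ≠ i → d < (x j 0).1} = Set.univ.pi A := by
    ext x
    simp only [Set.mem_ofPred_eq, Set.mem_pi, Set.mem_univ, true_imp_iff, A]
    refine forall_congr' fun j => ?_
    split_ifs with h <;> simp [h]
  have hfun : (fun (x : ι → ℕ → ℝ × ℝ) j => if j = i then x j else residualSeq d (x j)) =
      fun x j => g j (x j) := by
    funext x j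
    simp only [g]
    split_ifs <;> rfl
  have hprod : ∏ j, c j = ENNReal.ofReal (Real.exp (-((∑ j, l j - l i) * d))) := by
    rw [← Finset.mul_prod_erase _ _ (Finset.mem_univ i)]
    simp only [c, if_true, one_mul]
    rw [Finset.prod_congr rfl fun j hj => if_neg (Finset.ne_of_mem_erase hj),
      ← ENNReal.ofReal_prod_of_nonneg fun _ _ => (Real.exp_pos _).le, ← Real.exp_sum,
      Finset.sum_neg_distrib, ← Finset.sum_mul, ← Finset.sum_erase_eq_sub (Finset.mem_univ i)]
  have hm : Measurable fun (x : ι → ℕ → ℝ × ℝ) j => g j (x j) :=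
    measurable_pi_lambda _ fun j => (hg j).comp (measurable_pi_apply j)
  have hfin : ∀ j, IsFiniteMeasure (c j • markedStreamLaw (l j) (m j)) :=
    fun j => Measure.smul_finite _ (hc j)
  have hsig : ∀ j, SigmaFinite (((markedStreamLaw (l j) (m j)).restrict (A j)).map (g j)) :=
    fun j => by rw [hmap]; infer_instance
  have key : ((streamsLaw l m).restrict (Set.univ.pi A)).map
      (fun (x : ι → ℕ → ℝ × ℝ) j => g j (x j)) = (∏ j, c j) • streamsLaw l m := by
    unfold streamsLaw
    rw [Measure.restrict_pi_pi, Measure.pi_map_pi fun j => (hg j).aemeasurable]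
    exact (congrArg Measure.pi (funext hmap)).trans (pi_smul_measure _ c hc)
  rw [hset, lintegral_indicator (.univ_pi hA), ← hprod, ← smul_eq_mul, ← lintegral_smul_measure,
    ← key, lintegral_map hf hm]
  exact lintegral_congr fun x => congrArg f (congrFun hfun x)

omit [DiscreteMeasurableSpace ι] in
open Classical in
/-- The first customer of the superposition on the event that it belongs to stream `i`. -/
theorem lintegral_firstCustomer_eq (hl : ∀ i, 0 < l i) (i : ι)
    {F : (ℝ × ι × ℝ) × (ι → ℕ → ℝ × ℝ) → ℝ≥0∞} (hF : Measurable F) :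
    ∫⁻ x, {x : ι → ℕ → ℝ × ℝ | ∀ j, j ≠ i → (x i 0).1 < (x j 0).1}.indicator
      (fun x => F (((x i 0).1, i, (x i 0).2), removeFirst i (x i 0).1 x)) x ∂streamsLaw l m =
    ENNReal.ofReal (l i / ∑ j, l j) * ∫⁻ d, ∫⁻ s, ∫⁻ x, F ((d, i, s), x) ∂streamsLaw l m ∂m i
      ∂expMeasure (∑ j, l j) := by
  have hprob := fun i => isProbabilityMeasure_markedStreamLaw (hl i) (m i)
  have hprob' : IsProbabilityMeasure (streamsLaw l m) := isProbabilityMeasure_streamsLaw hl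
  have hexp := isProbabilityMeasure_expMeasure (hl i)
  have hexp' := isProbabilityMeasure_expMeasure (sum_rate_pos hl)
  have hS : MeasurableSet {x : ι → ℕ → ℝ × ℝ | ∀ j, j ≠ i → (x i 0).1 < (x j 0).1} := by
    simp only [Set.ofPred_forall]
    exact .iInter fun j => .iInter fun _ => measurableSet_lt (by fun_prop) (by fun_prop)
  have hrem : Measurable fun x : ι → ℕ → ℝ × ℝ => removeFirst i (x i 0).1 x := by
    have : Measurable fun x : ι → ℕ → ℝ × ℝ => ((x i 0).1, x) := by fun_prop
    exact (measurable_removeFirst i).comp this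
  have hG : Measurable fun x : ι → ℕ → ℝ × ℝ =>
      F (((x i 0).1, i, (x i 0).2), removeFirst i (x i 0).1 x) :=
    hF.comp (Measurable.prodMk (by fun_prop) hrem)
  have hcons : Measurable fun p : (ℝ × ℝ) × (ι → ℕ → ℝ × ℝ) =>
      F ((p.1.1, i, p.1.2), p.2) := hF.comp (by fun_prop)
  have hcons' : Measurable fun z : ℝ × ℝ =>
      ∫⁻ x, F ((z.1, i, z.2), x) ∂streamsLaw l m := hcons.lintegral_prod_right'
  -- With the first pair `z` of stream `i` frozen, `z.1` is a deterministic time for the other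
  -- streams, so their residuals can be replaced by fresh copies.
  have step : ∀ z : ℝ × ℝ, 0 ≤ z.1 → ∫⁻ s, ∫⁻ x,
      {x : ι → ℕ → ℝ × ℝ | ∀ j, j ≠ i → (x i 0).1 < (x j 0).1}.indicator
        (fun x => F (((x i 0).1, i, (x i 0).2), removeFirst i (x i 0).1 x))
        (Function.update x i (seqCons z s)) ∂streamsLaw l m ∂markedStreamLaw (l i) (m i) =
      ENNReal.ofReal (Real.exp (-((∑ j, l j - l i) * z.1))) *
        ∫⁻ x, F ((z.1, i, z.2), x) ∂streamsLaw l m := by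
    intro z hz
    have h1 : ∀ s x, {x : ι → ℕ → ℝ × ℝ | ∀ j, j ≠ i → (x i 0).1 < (x j 0).1}.indicator
        (fun x => F (((x i 0).1, i, (x i 0).2), removeFirst i (x i 0).1 x))
        (Function.update x i (seqCons z s)) =
        {x : ι → ℕ → ℝ × ℝ | ∀ j, j ≠ i → z.1 < (x j 0).1}.indicator
        (fun x => (fun y => F ((z.1, i, z.2), Function.update y i s))
          fun j => if j = i then x j else residualSeq z.1 (x j)) x := by
      intro s x
      have hz0 : Function.update x i (seqCons z s) i 0 = z := by
        rw [Function.update_self]; rfl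
      have hmem : Function.update x i (seqCons z s) ∈
          {x : ι → ℕ → ℝ × ℝ | ∀ j, j ≠ i → (x i 0).1 < (x j 0).1} ↔
          x ∈ {x : ι → ℕ → ℝ × ℝ | ∀ j, j ≠ i → z.1 < (x j 0).1} := by
        simp only [Set.mem_ofPred_eq, hz0]
        refine forall_congr' fun j => imp_congr_right fun hj => ?_
        rw [Function.update_of_ne hj]
      by_cases h : x ∈ {x : ι → ℕ → ℝ × ℝ | ∀ j, j ≠ i → z.1 < (x j 0).1}
      · rw [Set.indicator_of_mem h, Set.indicator_of_mem (hmem.2 h)]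
        simp only [hz0]
        congr 2
        funext j
        simp only [removeFirst]
        rcases eq_or_ne j i with rfl | hj
        · simp only [if_true, Function.update_self]; rfl
        · simp only [if_neg hj, Function.update_of_ne hj]
      · rw [Set.indicator_of_notMem h, Set.indicator_of_notMem (mt hmem.1 h)]
    simp_rw [h1]
    have h2 : ∀ s, Measurable fun y : ι → ℕ → ℝ × ℝ =>
        F ((z.1, i, z.2), Function.update y i s) := fun s => hF.comp (by fun_prop)
    simp_rw [fun s => lintegral_residual_streamsLaw (m := m) hl i hz (h2 s)]
    have h3 : Measurable fun s => ∫⁻ x, F ((z.1, i, z.2), Function.update x i s)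
        ∂streamsLaw l m := by
      have : Measurable fun p : (ℕ → ℝ × ℝ) × (ι → ℕ → ℝ × ℝ) =>
        F ((z.1, i, z.2), Function.update p.2 i p.1) := hF.comp (by fun_prop)
      exact this.lintegral_prod_right'
    rw [lintegral_const_mul _ h3]
    congr 1
    exact (lintegral_pi_update (fun i => markedStreamLaw (l i) (m i)) i
      (f := fun x => F ((z.1, i, z.2), x)) (hF.comp (by fun_prop))).symm
  have hpi := lintegral_pi_update (fun i => markedStreamLaw (l i) (m i)) i (hG.indicator hS)
  have hupd : Measurable fun p : (ℕ → ℝ × ℝ) × (ι → ℕ → ℝ × ℝ) =>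
      {x : ι → ℕ → ℝ × ℝ | ∀ j, j ≠ i → (x i 0).1 < (x j 0).1}.indicator
        (fun x => F (((x i 0).1, i, (x i 0).2), removeFirst i (x i 0).1 x))
        (Function.update p.2 i p.1) := by
    have : Measurable fun p : (ℕ → ℝ × ℝ) × (ι → ℕ → ℝ × ℝ) => Function.update p.2 i p.1 := by
      fun_prop
    exact (hG.indicator hS).comp this
  have hupd' := hupd.lintegral_prod_right' (ν := streamsLaw l m)
  have hseq := lintegral_infinitePi_seqCons ((expMeasure (l i)).prod (m i)) hupd'
  have hae : ∀ᵐ z ∂(expMeasure (l i)).prod (m i), 0 ≤ z.1 :=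
    Measure.quasiMeasurePreserving_fst.ae (ae_nonneg_expMeasure (hl i))
  have hcd : Measurable fun d => ∫⁻ s, ∫⁻ x, F ((d, i, s), x) ∂streamsLaw l m ∂m i :=
    hcons'.lintegral_prod_right'
  refine hpi.trans (hseq.trans ?_)
  refine (lintegral_congr_ae (hae.mono step)).trans ?_
  rw [lintegral_prod _ (by fun_prop)]
  have hcs : ∀ d, Measurable fun s => ∫⁻ x, F ((d, i, s), x) ∂streamsLaw l m := fun d =>
    hcons'.comp measurable_prodMk_left
  refine (lintegral_congr fun d => lintegral_const_mul
    (ENNReal.ofReal (Real.exp (-((∑ j, l j - l i) * d)))) (hcs d)).trans ?_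
  have hpos := sum_rate_pos hl
  -- Tilting the law of rate `l i` by the survival probability of the other streams produces both
  -- the total rate and the weight `l i / ∑ j, l j`.
  rw [lintegral_exp_mul_expMeasure (hl i) (by linarith) hcd, add_sub_cancel]

/-- **Superposition theorem**: the first customer of the superposition is independent of the
streams as seen from its arrival, which have the same law as the original ones. -/
theorem map_firstCustomer_shiftStreams (hl : ∀ i, 0 < l i) :
    (streamsLaw l m).map (fun x => (firstCustomer x, shiftStreams x)) =
      ((expMeasure (∑ j, l j)).prod (customerLaw l m)).prod (streamsLaw l m) := by
  have hprob : IsProbabilityMeasure (streamsLaw l m) := isProbabilityMeasure_streamsLaw hl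
  have hprob' : IsProbabilityMeasure (customerLaw l m) := isProbabilityMeasure_customerLaw hl
  have hexp := isProbabilityMeasure_expMeasure (sum_rate_pos hl)
  have hmeas : Measurable fun x : ι → ℕ → ℝ × ℝ => (firstCustomer x, shiftStreams x) :=
    measurable_firstCustomer.prodMk measurable_shiftStreams
  have := Measure.isProbabilityMeasure_map (μ := streamsLaw l m) hmeas.aemeasurable
  symm
  -- Between probability measures an inequality is enough. The product law is matched on the
  -- disjoint events of a strict minimum, so ties need not be shown to be null.
  refine Measure.eq_of_le_of_isProbabilityMeasure (Measure.le_iff.2 fun A hA => ?_)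
  let M : ι → Set (ι → ℕ → ℝ × ℝ) := fun i => {x | ∀ j, j ≠ i → (x i 0).1 < (x j 0).1}
  have hM : ∀ i, MeasurableSet (M i) := fun i => by
    simp only [M, Set.ofPred_forall]
    exact .iInter fun j => .iInter fun _ => measurableSet_lt (by fun_prop) (by fun_prop)
  have hfirst : ∀ i, ∀ x ∈ M i, firstStream x = i := fun i x hx => argmin_eq_of_forall_lt hx
  have hF : Measurable (A.indicator (1 : (ℝ × ι × ℝ) × (ι → ℕ → ℝ × ℝ) → ℝ≥0∞)) :=
    measurable_one.indicator hA
  have h1 : (((expMeasure (∑ j, l j)).prod (customerLaw l m)).prod (streamsLaw l m)) A =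
      ∑ i, ∫⁻ x, (M i).indicator (fun x => A.indicator 1
        (((x i 0).1, i, (x i 0).2), removeFirst i (x i 0).1 x)) x ∂streamsLaw l m := by
    have hz : Measurable fun z : ℝ × ι × ℝ => ∫⁻ x, A.indicator
        (1 : (ℝ × ι × ℝ) × (ι → ℕ → ℝ × ℝ) → ℝ≥0∞) (z, x) ∂streamsLaw l m :=
      hF.lintegral_prod_right'
    have hdi : ∀ i, Measurable fun d : ℝ => ∫⁻ s, ∫⁻ x, A.indicator
        (1 : (ℝ × ι × ℝ) × (ι → ℕ → ℝ × ℝ) → ℝ≥0∞) ((d, i, s), x) ∂streamsLaw l m ∂m i := by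
      intro i
      have : Measurable fun p : ℝ × ℝ => ∫⁻ x, A.indicator
        (1 : (ℝ × ι × ℝ) × (ι → ℕ → ℝ × ℝ) → ℝ≥0∞) ((p.1, i, p.2), x) ∂streamsLaw l m :=
        hz.comp (by fun_prop)
      exact this.lintegral_prod_right'
    refine Eq.trans ?_ (Finset.sum_congr rfl fun i _ =>
      (lintegral_firstCustomer_eq (m := m) hl i hF).symm)
    rw [← lintegral_indicator_one hA, lintegral_prod _ hF.aemeasurable,
      lintegral_prod _ hz.aemeasurable]
    refine (lintegral_congr fun d => lintegral_customerLaw (l := l) (m := m)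
      (hz.comp (measurable_prodMk_left (x := d)))).trans ?_
    simp only [Function.comp]
    rw [lintegral_finsetSum _ fun i _ => (hdi i).const_mul _]
    exact Finset.sum_congr rfl fun i _ => lintegral_const_mul _ (hdi i)
  rw [h1, Measure.map_apply hmeas hA, ← lintegral_indicator_one (hmeas hA),
    ← lintegral_finsetSum]
  · refine lintegral_mono fun x => ?_
    by_cases hx : ∃ i, x ∈ M i
    · obtain ⟨i, hi⟩ := hx
      rw [Finset.sum_eq_single i]
      · rw [Set.indicator_of_mem hi]
        have := hfirst i x hi
        have hx : (firstCustomer x, shiftStreams x) =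
            (((x i 0).1, i, (x i 0).2), removeFirst i (x i 0).1 x) := by
          simp only [firstCustomer, shiftStreams, this]
        rw [← hx]
        rfl
      · intro j _ hj
        refine Set.indicator_of_notMem (fun h => hj ?_) _
        rw [← hfirst i x hi, hfirst j x h]
      · simp
    · rw [Finset.sum_eq_zero]
      · exact zero_le
      · exact fun i _ => Set.indicator_of_notMem (fun h => hx ⟨i, h⟩) _
  · intro i _
    refine Measurable.indicator (hF.comp (Measurable.prodMk (by fun_prop) ?_)) (hM i)
    have : Measurable fun x : ι → ℕ → ℝ × ℝ => ((x i 0).1, x) := by fun_prop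
    exact (measurable_removeFirst i).comp this

end

end Superposition

/-! ### Coupling of Lindley recursions -/

section Coupling

theorem lindley_mono {d b Y Y' : ℕ → ℝ} (hY : ∀ n, Y (n + 1) = max (Y n - d n) 0 + b n)
    (hY' : ∀ n, Y' (n + 1) = max (Y' n - d n) 0 + b n) (h0 : Y 0 ≤ Y' 0) (n : ℕ) :
    Y n ≤ Y' n := by
  induction n with
  | zero => exact h0
  | succ n ih => rw [hY, hY']; gcongr

/-- Without emptying there is no truncation, and `Y n - d n` is a difference of partial sums that
drifts to `-∞` at rate `δ - β`. -/
theorem lindley_exists_empty {d b Y : ℕ → ℝ} {β δ : ℝ}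
    (hY : ∀ n, Y (n + 1) = max (Y n - d n) 0 + b n)
    (hb : Tendsto (fun n : ℕ => (∑ k ∈ Finset.range n, b k) / n) atTop (𝓝 β))
    (hd : Tendsto (fun n : ℕ => (∑ k ∈ Finset.range n, d k) / n) atTop (𝓝 δ)) (hβδ : β < δ) :
    ∃ n, Y n - d n ≤ 0 := by
  by_contra! hpos
  have hsum : ∀ n, Y n = Y 0 + ∑ k ∈ Finset.range n, b k - ∑ k ∈ Finset.range n, d k := by
    intro n
    induction n with
    | zero => simp
    | succ n ih =>
      rw [hY, max_eq_left (hpos n).le, ih, Finset.sum_range_succ, Finset.sum_range_succ]; ring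
  -- The last bracket is `d n / n`, written through averages so that its limit `0` follows from
  -- `hd`.
  have hlim : Tendsto (fun n : ℕ => Y 0 / n + (∑ k ∈ Finset.range n, b k) / n -
      (∑ k ∈ Finset.range n, d k) / n - ((∑ k ∈ Finset.range (n + 1), d k) / ((n + 1 : ℕ) : ℝ) *
        (((n : ℝ) + 1) / n) - (∑ k ∈ Finset.range n, d k) / n))
      atTop (𝓝 (0 + β - δ - (δ * 1 - δ))) := by
    have h1 : Tendsto (fun n : ℕ => ((n : ℝ) + 1) / n) atTop (𝓝 1) := by
      have := (tendsto_const_div_atTop_nhds_zero_nat (1 : ℝ)).const_add 1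
      rw [add_zero] at this
      refine this.congr' ?_
      filter_upwards [eventually_gt_atTop 0] with n hn
      have : (n : ℝ) ≠ 0 := by positivity
      field_simp
    exact (((tendsto_const_div_atTop_nhds_zero_nat (Y 0)).add hb).sub hd).sub
      (((hd.comp (tendsto_add_atTop_nat 1)).mul h1).sub hd)
  have hge : ∀ᶠ n : ℕ in atTop, 0 ≤ Y 0 / n + (∑ k ∈ Finset.range n, b k) / n -
      (∑ k ∈ Finset.range n, d k) / n - ((∑ k ∈ Finset.range (n + 1), d k) / ((n + 1 : ℕ) : ℝ) *
        (((n : ℝ) + 1) / n) - (∑ k ∈ Finset.range n, d k) / n) := by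
    filter_upwards [eventually_gt_atTop 0] with n hn
    have hn' : (0 : ℝ) < n := by exact_mod_cast hn
    have h := hpos n
    rw [hsum n] at h
    have e : Y 0 / n + (∑ k ∈ Finset.range n, b k) / n -
      (∑ k ∈ Finset.range n, d k) / n - ((∑ k ∈ Finset.range (n + 1), d k) / ((n + 1 : ℕ) : ℝ) *
        (((n : ℝ) + 1) / n) - (∑ k ∈ Finset.range n, d k) / n) =
      (Y 0 + ∑ k ∈ Finset.range n, b k - ∑ k ∈ Finset.range n, d k - d n) / n := by
      rw [Finset.sum_range_succ]
      push_cast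
      field_simp
      ring
    rw [e]
    exact div_nonneg h.le hn'.le
  have := ge_of_tendsto hlim hge
  linarith

/-- Two workload processes driven by the same input in a stable queue eventually coincide. -/
theorem lindley_coupling {d b Y Y' : ℕ → ℝ} {β δ : ℝ}
    (hY : ∀ n, Y (n + 1) = max (Y n - d n) 0 + b n)
    (hY' : ∀ n, Y' (n + 1) = max (Y' n - d n) 0 + b n)
    (hb : Tendsto (fun n : ℕ => (∑ k ∈ Finset.range n, b k) / n) atTop (𝓝 β))
    (hd : Tendsto (fun n : ℕ => (∑ k ∈ Finset.range n, d k) / n) atTop (𝓝 δ)) (hβδ : β < δ) :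
    ∀ᶠ n in atTop, max (Y n - d n) 0 = max (Y' n - d n) 0 := by
  wlog h0 : Y 0 ≤ Y' 0 generalizing Y Y'
  · exact (this hY' hY (not_le.1 h0).le).mono fun n h => h.symm
  -- When the larger process empties, so does the smaller one; from then on both obey the same
  -- recursion from the same value.
  obtain ⟨N, hN⟩ := lindley_exists_empty hY' hb hd hβδ
  refine eventually_atTop.2 ⟨N, fun n hn => ?_⟩
  induction n, hn using Nat.le_induction with
  | base =>
    rw [max_eq_right hN, max_eq_right]
    linarith [lindley_mono hY hY' h0 N]
  | succ n _ ih => rw [hY, hY', ih]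

end Coupling

/-! ### Successive customers of the superposition -/

section Customers

open scoped ENNReal

variable {ι : Type*} [Fintype ι] [Nonempty ι]

/-- The arrival gap, the stream and the service time of the `n`-th customer. -/
noncomputable def nthCustomer (n : ℕ) (x : ι → ℕ → ℝ × ℝ) : ℝ × ι × ℝ :=
  firstCustomer (shiftStreams^[n] x)

variable [MeasurableSpace ι] [DiscreteMeasurableSpace ι] {l : ι → ℝ} {m : ι → Measure ℝ}
  [∀ i, IsProbabilityMeasure (m i)]

omit [∀ i, IsProbabilityMeasure (m i)] in
theorem measurable_nthCustomer (n : ℕ) :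
    Measurable (nthCustomer n : (ι → ℕ → ℝ × ℝ) → ℝ × ι × ℝ) :=
  measurable_firstCustomer.comp (measurable_shiftStreams.iterate n)

theorem measurePreserving_shiftStreams (hl : ∀ i, 0 < l i) :
    MeasurePreserving shiftStreams (streamsLaw l m) (streamsLaw l m) := by
  have hprob : IsProbabilityMeasure (streamsLaw l m) := isProbabilityMeasure_streamsLaw hl
  have hprob' : IsProbabilityMeasure (customerLaw l m) := isProbabilityMeasure_customerLaw hl
  have hexp := isProbabilityMeasure_expMeasure (sum_rate_pos hl)
  refine ⟨measurable_shiftStreams, ?_⟩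
  have h := congrArg (Measure.map Prod.snd) (map_firstCustomer_shiftStreams (m := m) hl)
  rw [Measure.map_map measurable_snd
    (measurable_firstCustomer.prodMk measurable_shiftStreams)] at h
  refine h.trans ?_
  simp

theorem measurePreserving_firstCustomer (hl : ∀ i, 0 < l i) :
    MeasurePreserving firstCustomer (streamsLaw l m)
      ((expMeasure (∑ i, l i)).prod (customerLaw l m)) := by
  have hprob : IsProbabilityMeasure (streamsLaw l m) := isProbabilityMeasure_streamsLaw hl
  refine ⟨measurable_firstCustomer, ?_⟩
  have h := congrArg (Measure.map Prod.fst) (map_firstCustomer_shiftStreams (m := m) hl)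
  rw [Measure.map_map measurable_fst
    (measurable_firstCustomer.prodMk measurable_shiftStreams)] at h
  refine h.trans ?_
  simp

theorem measurePreserving_nthCustomer (hl : ∀ i, 0 < l i) (n : ℕ) :
    MeasurePreserving (nthCustomer n) (streamsLaw l m)
      ((expMeasure (∑ i, l i)).prod (customerLaw l m)) :=
  (measurePreserving_firstCustomer hl).comp ((measurePreserving_shiftStreams hl).iterate n)

/-- The shift preserves the law, so `j` may be moved to `0`; the later customer is then a function
of the shifted streams. Pairwise independence is all that the strong law needs. -/
theorem indepFun_nthCustomer_of_lt (hl : ∀ i, 0 < l i) {j k : ℕ} (hjk : j < k) :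
    nthCustomer j ⟂ᵢ[streamsLaw l m] nthCustomer k := by
  have hprob : IsProbabilityMeasure (streamsLaw l m) := isProbabilityMeasure_streamsLaw hl
  obtain ⟨i, rfl⟩ := Nat.exists_eq_add_of_lt hjk
  have h0 : firstCustomer ⟂ᵢ[streamsLaw l m] shiftStreams := by
    rw [indepFun_iff_map_prod_eq_prod_map_map measurable_firstCustomer.aemeasurable
      measurable_shiftStreams.aemeasurable, map_firstCustomer_shiftStreams hl,
      (measurePreserving_firstCustomer hl).map_eq, (measurePreserving_shiftStreams hl).map_eq]
  have h1 : firstCustomer ⟂ᵢ[streamsLaw l m] (nthCustomer i ∘ shiftStreams) :=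
    h0.comp measurable_id (measurable_nthCustomer i)
  have hT := (measurePreserving_shiftStreams (m := m) hl).iterate j
  have he : nthCustomer (j + i + 1) =
      (nthCustomer i ∘ shiftStreams) ∘ (shiftStreams (ι := ι))^[j] := by
    funext x
    simp only [nthCustomer, Function.comp]
    rw [← Function.iterate_succ_apply, ← Function.iterate_add_apply]
    congr 2
    omega
  rw [he]
  have hm1 := measurable_firstCustomer (ι := ι)
  have hm2 : Measurable (nthCustomer i ∘ shiftStreams : (ι → ℕ → ℝ × ℝ) → ℝ × ι × ℝ) :=
    (measurable_nthCustomer i).comp measurable_shiftStreams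
  rw [← hT.map_eq] at h1
  rw [indepFun_iff_map_prod_eq_prod_map_map hm1.aemeasurable hm2.aemeasurable,
    Measure.map_map (hm1.prodMk hm2) hT.measurable, Measure.map_map hm1 hT.measurable,
    Measure.map_map hm2 hT.measurable] at h1
  exact (indepFun_iff_map_prod_eq_prod_map_map (hm1.comp hT.measurable).aemeasurable
    (hm2.comp hT.measurable).aemeasurable).2 h1

/-- Strong law of large numbers along the customers of the superposition. -/
theorem strong_law_nthCustomer (hl : ∀ i, 0 < l i) {h : ℝ × ι × ℝ → ℝ} (hm : Measurable h)
    (hint : Integrable h ((expMeasure (∑ i, l i)).prod (customerLaw l m))) :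
    ∀ᵐ x ∂streamsLaw l m, Tendsto
      (fun n : ℕ => (∑ k ∈ Finset.range n, h (nthCustomer k x)) / n) atTop
      (𝓝 (∫ z, h z ∂(expMeasure (∑ i, l i)).prod (customerLaw l m))) := by
  have hmp := fun n => measurePreserving_nthCustomer (m := m) hl n
  have hlaw := strong_law_ae_real (μ := streamsLaw l m) (fun n x => h (nthCustomer n x))
    ((hmp 0).integrable_comp_of_integrable hint) ?_ ?_
  · rw [← (hmp 0).map_eq, integral_map (hmp 0).measurable.aemeasurable
      hm.aestronglyMeasurable]
    exact hlaw
  · intro j k hjk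
    rcases lt_or_gt_of_ne hjk with hlt | hlt
    · exact (indepFun_nthCustomer_of_lt hl hlt).comp hm hm
    · exact ((indepFun_nthCustomer_of_lt hl hlt).comp hm hm).symm
  · intro n
    have : IdentDistrib (nthCustomer n) (nthCustomer 0) (streamsLaw l m) (streamsLaw l m) :=
      ⟨(hmp n).measurable.aemeasurable, (hmp 0).measurable.aemeasurable,
        (hmp n).map_eq.trans (hmp 0).map_eq.symm⟩
    exact this.comp hm

end Customers

/-! ### A queue fed by part of the superposition -/

section Queue

open scoped ENNReal

variable {ι : Type*} [Fintype ι] [Nonempty ι]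

/-- The work left at the arrival of the first customer if the initial work is `y`. -/
noncomputable def remainingWork (p : ℝ × (ι → ℕ → ℝ × ℝ)) : ℝ :=
  max (p.1 - (firstCustomer p.2).1) 0

/-- The work in a queue just after the arrival of the first customer, who brings the work `B`,
together with the streams as seen from this arrival. -/
noncomputable def queueStep (B : ι × ℝ → ℝ) (p : ℝ × (ι → ℕ → ℝ × ℝ)) :
    ℝ × (ι → ℕ → ℝ × ℝ) :=
  (remainingWork p + B (firstCustomer p.2).2, shiftStreams p.2)

theorem iterate_queueStep_snd (B : ι × ℝ → ℝ) (n : ℕ) (p : ℝ × (ι → ℕ → ℝ × ℝ)) :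
    ((queueStep B)^[n] p).2 = shiftStreams^[n] p.2 := by
  induction n with
  | zero => rfl
  | succ n ih => rw [Function.iterate_succ_apply', Function.iterate_succ_apply', ← ih]; rfl

variable [MeasurableSpace ι] [DiscreteMeasurableSpace ι]

theorem measurable_remainingWork :
    Measurable (remainingWork : ℝ × (ι → ℕ → ℝ × ℝ) → ℝ) :=
  (measurable_fst.sub (measurable_firstCustomer.comp measurable_snd).fst).max measurable_const

theorem measurable_queueStep {B : ι × ℝ → ℝ} (hB : Measurable B) :
    Measurable (queueStep B) :=
  (measurable_remainingWork.add (hB.comp (measurable_firstCustomer.comp measurable_snd).snd)).prodMk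
    (measurable_shiftStreams.comp measurable_snd)

variable {l : ι → ℝ} {m : ι → Measure ℝ} [∀ i, IsProbabilityMeasure (m i)]

/-- The remaining work is a function of the initial work and the first gap only, and both are
independent of the first mark and of the shifted streams. -/
theorem map_remainingWork_prod (hl : ∀ i, 0 < l i) {σ κ : Measure ℝ} [IsProbabilityMeasure σ]
    [IsProbabilityMeasure κ]
    (hκ : (σ.prod (expMeasure (∑ i, l i))).map (fun p => max (p.1 - p.2) 0) = κ) :
    (σ.prod (streamsLaw l m)).map
      (fun p => (remainingWork p, (firstCustomer p.2).2, shiftStreams p.2)) =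
      κ.prod ((customerLaw l m).prod (streamsLaw l m)) := by
  have hprob : IsProbabilityMeasure (streamsLaw l m) := isProbabilityMeasure_streamsLaw hl
  have hprob' : IsProbabilityMeasure (customerLaw l m) := isProbabilityMeasure_customerLaw hl
  have hexp := isProbabilityMeasure_expMeasure (sum_rate_pos hl)
  have hH : Measurable fun p : ℝ × (ι → ℕ → ℝ × ℝ) =>
      (remainingWork p, (firstCustomer p.2).2, shiftStreams p.2) :=
    measurable_remainingWork.prodMk ((measurable_firstCustomer.comp measurable_snd).snd.prodMk
      (measurable_shiftStreams.comp measurable_snd))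
  have hmeas : Measurable fun x : ι → ℕ → ℝ × ℝ => (firstCustomer x, shiftStreams x) :=
    measurable_firstCustomer.prodMk measurable_shiftStreams
  refine Measure.ext_of_lintegral _ fun f hf => ?_
  have hmax : Measurable fun p : ℝ × ℝ => max (p.1 - p.2) 0 := by fun_prop
  have hfH : Measurable fun p : ℝ × (ι → ℕ → ℝ × ℝ) =>
      f (remainingWork p, (firstCustomer p.2).2, shiftStreams p.2) := hf.comp hH
  have hk : Measurable fun w : ℝ => ∫⁻ z, ∫⁻ x, f (w, z, x) ∂streamsLaw l m ∂customerLaw l m := by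
    have : Measurable fun q : (ℝ × (ι × ℝ)) × (ι → ℕ → ℝ × ℝ) => f (q.1.1, q.1.2, q.2) :=
      hf.comp (by fun_prop)
    exact (this.lintegral_prod_right').lintegral_prod_right'
  rw [lintegral_map hf hH, lintegral_prod _ hfH.aemeasurable,
    lintegral_prod _ hf.aemeasurable]
  have h1 : ∀ w, ∫⁻ q, f (w, q) ∂(customerLaw l m).prod (streamsLaw l m) =
      ∫⁻ z, ∫⁻ x, f (w, z, x) ∂streamsLaw l m ∂customerLaw l m := fun w =>
    lintegral_prod _ (hf.comp measurable_prodMk_left).aemeasurable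
  simp_rw [h1]
  have hkm : Measurable fun p : ℝ × ℝ => ∫⁻ z, ∫⁻ x, f (max (p.1 - p.2) 0, z, x)
      ∂streamsLaw l m ∂customerLaw l m := hk.comp hmax
  rw [← hκ, lintegral_map hk hmax, lintegral_prod _ hkm.aemeasurable]
  refine lintegral_congr fun y => ?_
  have hf' : Measurable fun u : (ℝ × ι × ℝ) × (ι → ℕ → ℝ × ℝ) =>
      f (max (y - u.1.1) 0, u.1.2, u.2) := hf.comp (by fun_prop)
  have h2 : ∫⁻ x, f (remainingWork (y, x), (firstCustomer x).2, shiftStreams x) ∂streamsLaw l m =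
      ∫⁻ u, f (max (y - u.1.1) 0, u.1.2, u.2)
        ∂((streamsLaw l m).map fun x => (firstCustomer x, shiftStreams x)) := by
    rw [lintegral_map hf' hmeas]; rfl
  refine h2.trans ?_
  rw [map_firstCustomer_shiftStreams hl, lintegral_prod _ hf'.aemeasurable,
    lintegral_prod _ hf'.lintegral_prod_right'.aemeasurable]

/-- The stationary law is invariant under the arrival of a customer with mark in `Q`, if the work
brought by such a customer has the same law as the work brought by an arbitrary one. -/
theorem map_queueStep_restrict (hl : ∀ i, 0 < l i) {σ κ b : Measure ℝ} [IsProbabilityMeasure σ]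
    [IsProbabilityMeasure κ] [IsProbabilityMeasure b]
    (hκ : (σ.prod (expMeasure (∑ i, l i))).map (fun p => max (p.1 - p.2) 0) = κ)
    (hσ : κ.conv b = σ) {B : ι × ℝ → ℝ} (hB : Measurable B) {Q : Set (ι × ℝ)}
    (hQ : MeasurableSet Q) {c : ℝ≥0∞} (hc : ((customerLaw l m).restrict Q).map B = c • b) :
    ((σ.prod (streamsLaw l m)).restrict {p | (firstCustomer p.2).2 ∈ Q}).map (queueStep B) =
      c • σ.prod (streamsLaw l m) := by
  have hprob : IsProbabilityMeasure (streamsLaw l m) := isProbabilityMeasure_streamsLaw hl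
  have hprob' : IsProbabilityMeasure (customerLaw l m) := isProbabilityMeasure_customerLaw hl
  have hH : Measurable fun p : ℝ × (ι → ℕ → ℝ × ℝ) =>
      (remainingWork p, (firstCustomer p.2).2, shiftStreams p.2) :=
    measurable_remainingWork.prodMk ((measurable_firstCustomer.comp measurable_snd).snd.prodMk
      (measurable_shiftStreams.comp measurable_snd))
  have hg : Measurable fun q : ℝ × (ι × ℝ) × (ι → ℕ → ℝ × ℝ) => (q.1 + B q.2.1, q.2.2) := by
    fun_prop
  have hS : MeasurableSet (Set.univ ×ˢ (Q ×ˢ Set.univ) : Set (ℝ × (ι × ℝ) × (ι → ℕ → ℝ × ℝ))) :=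
    .prod .univ (hQ.prod .univ)
  have hset : {p : ℝ × (ι → ℕ → ℝ × ℝ) | (firstCustomer p.2).2 ∈ Q} =
      (fun p : ℝ × (ι → ℕ → ℝ × ℝ) =>
        (remainingWork p, (firstCustomer p.2).2, shiftStreams p.2)) ⁻¹'
        (Set.univ ×ˢ (Q ×ˢ Set.univ)) := by
    ext p; simp
  have hcomp : queueStep B = (fun q : ℝ × (ι × ℝ) × (ι → ℕ → ℝ × ℝ) => (q.1 + B q.2.1, q.2.2)) ∘
      fun p => (remainingWork p, (firstCustomer p.2).2, shiftStreams p.2) := rfl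
  rw [hset, hcomp, ← Measure.map_map hg hH, ← Measure.restrict_map hH hS,
    map_remainingWork_prod hl hκ, ← Measure.prod_restrict, ← Measure.prod_restrict,
    Measure.restrict_univ, Measure.restrict_univ]
  refine Measure.ext_of_lintegral _ fun f hf => ?_
  have hk : Measurable fun w : ℝ => ∫⁻ x, f (w, x) ∂streamsLaw l m := hf.lintegral_prod_right'
  have hfg : Measurable fun q : ℝ × (ι × ℝ) × (ι → ℕ → ℝ × ℝ) => f (q.1 + B q.2.1, q.2.2) :=
    hf.comp hg
  rw [lintegral_map hf hg, lintegral_prod _ hfg.aemeasurable, lintegral_smul_measure,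
    lintegral_prod _ hf.aemeasurable, ← hσ, Measure.lintegral_conv hk, smul_eq_mul]
  have hk2 : Measurable fun w : ℝ => ∫⁻ y, ∫⁻ x, f (w + y, x) ∂streamsLaw l m ∂b := by
    have : Measurable fun p : ℝ × ℝ => ∫⁻ x, f (p.1 + p.2, x) ∂streamsLaw l m :=
      hk.comp (by fun_prop)
    exact this.lintegral_prod_right'
  rw [← lintegral_const_mul _ hk2]
  refine lintegral_congr fun w => ?_
  have hkw : Measurable fun y : ℝ => ∫⁻ x, f (w + y, x) ∂streamsLaw l m :=
    hk.comp (measurable_const_add w)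
  rw [← smul_eq_mul, ← lintegral_smul_measure, ← hc, lintegral_map hkw hB]
  refine lintegral_prod (fun q : (ι × ℝ) × (ι → ℕ → ℝ × ℝ) => f (w + B q.1, q.2)) ?_
  exact (hf.comp (by fun_prop)).aemeasurable

open Classical in
/-- The number of customers with mark in `Q` among the first `n` customers. -/
noncomputable def countMark (Q : Set (ι × ℝ)) (n : ℕ) (x : ι → ℕ → ℝ × ℝ) : ℕ :=
  Nat.count (fun k => (nthCustomer k x).2 ∈ Q) n

omit [MeasurableSpace ι] [DiscreteMeasurableSpace ι] in
theorem countMark_succ (Q : Set (ι × ℝ)) (n : ℕ) (x : ι → ℕ → ℝ × ℝ)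
    [Decidable ((nthCustomer n x).2 ∈ Q)] :
    countMark Q (n + 1) x = countMark Q n x + if (nthCustomer n x).2 ∈ Q then 1 else 0 := by
  classical
  rw [countMark, Nat.count_succ]
  congr

theorem measurable_countMark {Q : Set (ι × ℝ)} (hQ : MeasurableSet Q) (n : ℕ) :
    Measurable (countMark Q n) := by
  classical
  induction n with
  | zero =>
    have : countMark Q 0 = fun _ => 0 := funext fun x => Nat.count_zero _
    rw [this]
    exact measurable_const
  | succ n ih =>
    have : countMark Q (n + 1) = fun x => countMark Q n x +
      if (nthCustomer n x).2 ∈ Q then 1 else 0 := funext fun x => countMark_succ Q n x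
    rw [this]
    exact ih.add (Measurable.ite ((measurable_nthCustomer n).snd hQ) measurable_const
      measurable_const)

/-- The stationary law is independent of the number of earlier customers with mark in `Q`. -/
theorem exists_map_iterate_queueStep_restrict (hl : ∀ i, 0 < l i) {σ κ b : Measure ℝ}
    [IsProbabilityMeasure σ] [IsProbabilityMeasure κ] [IsProbabilityMeasure b]
    (hκ : (σ.prod (expMeasure (∑ i, l i))).map (fun p => max (p.1 - p.2) 0) = κ)
    (hσ : κ.conv b = σ) {B : ι × ℝ → ℝ} (hB : Measurable B) {Q : Set (ι × ℝ)}
    (hQ : MeasurableSet Q) {c c' : ℝ≥0∞} (hc : ((customerLaw l m).restrict Q).map B = c • b)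
    (hc' : ((customerLaw l m).restrict Qᶜ).map B = c' • b) (n k : ℕ) :
    ∃ β : ℝ≥0∞, ((σ.prod (streamsLaw l m)).restrict {p | countMark Q n p.2 = k}).map
      (queueStep B)^[n] = β • σ.prod (streamsLaw l m) := by
  classical
  have hG := measurable_queueStep hB
  have hD : ∀ Q : Set (ι × ℝ), MeasurableSet Q →
      MeasurableSet {p : ℝ × (ι → ℕ → ℝ × ℝ) | (firstCustomer p.2).2 ∈ Q} := fun Q hQ =>
    (measurable_firstCustomer.comp measurable_snd).snd hQ
  have hC : ∀ n k, MeasurableSet {p : ℝ × (ι → ℕ → ℝ × ℝ) | countMark Q n p.2 = k} := fun n k =>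
    ((measurable_countMark hQ n).comp measurable_snd) (measurableSet_singleton k)
  -- One more customer, whose mark lies in `Q'`: it is the first customer of the state after `n`
  -- steps, whose restricted law is already a multiple of the stationary one.
  have hstep : ∀ (Q' : Set (ι × ℝ)) (_ : MeasurableSet Q') (c : ℝ≥0∞)
      (_ : ((customerLaw l m).restrict Q').map B = c • b) (n k : ℕ) (β : ℝ≥0∞)
      (_ : ((σ.prod (streamsLaw l m)).restrict {p | countMark Q n p.2 = k}).map
      (queueStep B)^[n] = β • σ.prod (streamsLaw l m)),
      ((σ.prod (streamsLaw l m)).restrict ({p | countMark Q n p.2 = k} ∩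
        {p | (nthCustomer n p.2).2 ∈ Q'})).map (queueStep B)^[n + 1] =
        (β * c) • σ.prod (streamsLaw l m) := by
    intro Q' hQ' c hc n k β hβ
    have hset : {p : ℝ × (ι → ℕ → ℝ × ℝ) | (nthCustomer n p.2).2 ∈ Q'} =
        (queueStep B)^[n] ⁻¹' {p | (firstCustomer p.2).2 ∈ Q'} := by
      ext p
      simp [nthCustomer, iterate_queueStep_snd]
    rw [Function.iterate_succ', ← Measure.map_map hG (hG.iterate n), Set.inter_comm, hset,
      ← Measure.restrict_restrict ((hG.iterate n) (hD Q' hQ')),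
      ← Measure.restrict_map (hG.iterate n) (hD Q' hQ'), hβ, Measure.restrict_smul,
      Measure.map_smul, map_queueStep_restrict hl hκ hσ hB hQ' hc, smul_smul]
  induction n generalizing k with
  | zero =>
    rcases k.eq_zero_or_pos with rfl | hk
    · exact ⟨1, by simp [countMark, Measure.map_id]⟩
    · refine ⟨0, ?_⟩
      have : {p : ℝ × (ι → ℕ → ℝ × ℝ) | countMark Q 0 p.2 = k} = ∅ := by
        ext p; simp [countMark, hk.ne]
      rw [this]; simp
  | succ n ih =>
    obtain ⟨β, hβ⟩ := ih k
    rcases k.eq_zero_or_pos with rfl | hk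
    · refine ⟨β * c', ?_⟩
      rw [← hstep Qᶜ hQ.compl c' hc' n 0 β hβ]
      congr 2
      ext p
      simp only [Set.mem_ofPred_eq, countMark_succ, Set.mem_inter_iff, Set.mem_compl_iff]
      split_ifs with h <;> simp [h]
    · obtain ⟨β', hβ'⟩ := ih (k - 1)
      -- A count of `k` after `n + 1` customers comes from `k` and a mark outside `Q`, or from `k -
      -- 1` and a mark in `Q`.
      refine ⟨β * c' + β' * c, ?_⟩
      have hset : {p : ℝ × (ι → ℕ → ℝ × ℝ) | countMark Q (n + 1) p.2 = k} =
          ({p | countMark Q n p.2 = k} ∩ {p | (nthCustomer n p.2).2 ∈ Qᶜ}) ∪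
          ({p | countMark Q n p.2 = k - 1} ∩ {p | (nthCustomer n p.2).2 ∈ Q}) := by
        ext p
        simp only [Set.mem_ofPred_eq, countMark_succ, Set.mem_inter_iff, Set.mem_compl_iff,
          Set.mem_union]
        split_ifs with h
        · simp only [h, not_true, and_false, and_true, false_or]; omega
        · simp [h]
      have hdisj : Disjoint ({p : ℝ × (ι → ℕ → ℝ × ℝ) | countMark Q n p.2 = k} ∩
          {p | (nthCustomer n p.2).2 ∈ Qᶜ})
          ({p | countMark Q n p.2 = k - 1} ∩ {p | (nthCustomer n p.2).2 ∈ Q}) :=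
        Set.disjoint_left.2 fun p hp hp' => hp.2 hp'.2
      have hN : MeasurableSet {p : ℝ × (ι → ℕ → ℝ × ℝ) | (nthCustomer n p.2).2 ∈ Q} :=
        ((measurable_nthCustomer n).comp measurable_snd).snd hQ
      rw [hset, Measure.restrict_union hdisj ((hC n (k - 1)).inter hN), Measure.map_add _ _
        (hG.iterate _), hstep Qᶜ hQ.compl c' hc' n k β hβ, hstep Q hQ c hc n (k - 1) β' hβ',
        add_smul]

end Queue

/-! ### The state found by the `n`-th customer of a class -/

section Queue

open scoped ENNReal

variable {ι : Type*} [Fintype ι] [Nonempty ι]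

/-- The index of the `n`-th customer with mark in `Q`. -/
noncomputable def markIndex (Q : Set (ι × ℝ)) (n : ℕ) (x : ι → ℕ → ℝ × ℝ) : ℕ :=
  Nat.nth (fun k => (nthCustomer k x).2 ∈ Q) n

theorem markIndex_eq {Q : Set (ι × ℝ)} {n k : ℕ} {x : ι → ℕ → ℝ × ℝ}
    (h : countMark Q k x = n) (hk : (nthCustomer k x).2 ∈ Q) : markIndex Q n x = k := by
  classical
  rw [← h, countMark, markIndex]
  exact Nat.nth_count (p := fun k => (nthCustomer k x).2 ∈ Q) hk

theorem countMark_markIndex {Q : Set (ι × ℝ)} {n : ℕ} {x : ι → ℕ → ℝ × ℝ}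
    (h : ∀ hf : {k | (nthCustomer k x).2 ∈ Q}.Finite, n < hf.toFinset.card) :
    countMark Q (markIndex Q n x) x = n ∧ (nthCustomer (markIndex Q n x) x).2 ∈ Q := by
  classical
  exact ⟨Nat.count_nth h, Nat.nth_mem n h⟩

variable [MeasurableSpace ι] [DiscreteMeasurableSpace ι]

theorem measurable_markIndex {Q : Set (ι × ℝ)} (hQ : MeasurableSet Q) (n : ℕ) :
    Measurable (markIndex Q n) := by
  have hS : ∀ k, MeasurableSet {x | countMark Q k x = n ∧ (nthCustomer k x).2 ∈ Q} := fun k =>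
    ((measurable_countMark hQ k) (measurableSet_singleton n)).inter
      ((measurable_nthCustomer k).snd hQ)
  -- `Nat.nth` returns `0` when there are too few marks, so only nonzero values have this
  -- description; the value `0` is handled by complement.
  have hpos : ∀ k, k ≠ 0 → markIndex Q n ⁻¹' {k} =
      {x | countMark Q k x = n ∧ (nthCustomer k x).2 ∈ Q} := by
    intro k hk
    ext x
    refine ⟨fun h => ?_, fun h => markIndex_eq h.1 h.2⟩
    have h : markIndex Q n x = k := h
    rw [← h]
    refine countMark_markIndex fun hf => ?_
    by_contra hlt
    exact hk (h.symm.trans (Nat.nth_of_card_le hf (not_lt.1 hlt)))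
  refine measurable_to_countable' fun k => ?_
  rcases eq_or_ne k 0 with rfl | hk
  · have : markIndex Q n ⁻¹' {0} = (⋃ k ∈ {k : ℕ | k ≠ 0}, markIndex Q n ⁻¹' {k})ᶜ := by
      ext x
      simp only [Set.mem_preimage, Set.mem_singleton_iff, Set.mem_compl_iff, Set.mem_iUnion,
        Set.mem_ofPred_eq, not_exists]
      exact ⟨fun h i hi h' => hi (h'.symm.trans h), fun h => by_contra fun h0 => h _ h0 rfl⟩
    rw [this]
    refine (MeasurableSet.biUnion (Set.to_countable _) fun k hk => ?_).compl
    rw [hpos k hk]; exact hS k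
  · rw [hpos k hk]; exact hS k

variable {l : ι → ℝ} {m : ι → Measure ℝ} [∀ i, IsProbabilityMeasure (m i)]

/-- By the strong law the frequency of marks in `Q` has a positive limit, whereas finitely many
marks would give frequency zero. -/
theorem ae_infinite_mark (hl : ∀ i, 0 < l i) {Q : Set (ι × ℝ)} (hQ : MeasurableSet Q)
    (h0 : customerLaw l m Q ≠ 0) :
    ∀ᵐ x ∂streamsLaw l m, {k | (nthCustomer k x).2 ∈ Q}.Infinite := by
  classical
  have hprob' : IsProbabilityMeasure (customerLaw l m) := isProbabilityMeasure_customerLaw hl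
  have hexp := isProbabilityMeasure_expMeasure (sum_rate_pos hl)
  have hQ' : MeasurableSet (Prod.snd ⁻¹' Q : Set (ℝ × ι × ℝ)) := measurable_snd hQ
  have hslln := strong_law_nthCustomer (m := m) hl
    (h := (Prod.snd ⁻¹' Q : Set (ℝ × ι × ℝ)).indicator 1) (measurable_one.indicator hQ')
    ((integrable_const (1 : ℝ)).indicator hQ')
  have hval : 0 < ∫ z, (Prod.snd ⁻¹' Q : Set (ℝ × ι × ℝ)).indicator (1 : ℝ × ι × ℝ → ℝ) z
      ∂(expMeasure (∑ i, l i)).prod (customerLaw l m) := by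
    rw [integral_indicator_one hQ', measureReal_def, ← Set.univ_prod, Measure.prod_prod,
      measure_univ, one_mul]
    exact ENNReal.toReal_pos h0 (measure_ne_top _ _)
  filter_upwards [hslln] with x hx hfin
  have hbound : ∀ n : ℕ, ∑ k ∈ Finset.range n,
      (Prod.snd ⁻¹' Q : Set (ℝ × ι × ℝ)).indicator (1 : ℝ × ι × ℝ → ℝ) (nthCustomer k x) ≤
      hfin.toFinset.card := by
    intro n
    have : ∀ k, (Prod.snd ⁻¹' Q : Set (ℝ × ι × ℝ)).indicator (1 : ℝ × ι × ℝ → ℝ)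
        (nthCustomer k x) = if k ∈ hfin.toFinset then 1 else 0 := by
      intro k
      simp [Set.indicator]
    simp_rw [this]
    rw [Finset.sum_boole]
    exact_mod_cast Finset.card_le_card fun k hk => (Finset.mem_filter.1 hk).2
  have hlim : Tendsto (fun n : ℕ => (hfin.toFinset.card : ℝ) / n) atTop (𝓝 0) :=
    tendsto_const_div_atTop_nhds_zero_nat _
  have := le_of_tendsto_of_tendsto' hx hlim fun n => by
    have := hbound n
    gcongr
  linarith

/-- The stationary law observed at the arrival of the `n`-th customer with mark in `Q`. -/
theorem measure_iterate_queueStep_markIndex (hl : ∀ i, 0 < l i) {σ κ b : Measure ℝ}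
    [IsProbabilityMeasure σ] [IsProbabilityMeasure κ] [IsProbabilityMeasure b]
    (hκ : (σ.prod (expMeasure (∑ i, l i))).map (fun p => max (p.1 - p.2) 0) = κ)
    (hσ : κ.conv b = σ) {B : ι × ℝ → ℝ} (hB : Measurable B) {Q : Set (ι × ℝ)}
    (hQ : MeasurableSet Q) {c c' : ℝ≥0∞} (hc : ((customerLaw l m).restrict Q).map B = c • b)
    (hc' : ((customerLaw l m).restrict Qᶜ).map B = c' • b) (hc0 : c ≠ 0) (n : ℕ)
    {D : Set (ℝ × (ι → ℕ → ℝ × ℝ))} (hD : MeasurableSet D) {q : ℝ≥0∞}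
    (hq : (σ.prod (streamsLaw l m)) ({p | (firstCustomer p.2).2 ∈ Q} ∩ D) = c * q) :
    (σ.prod (streamsLaw l m)) {p | (queueStep B)^[markIndex Q n p.2] p ∈ D} = q := by
  have hprob : IsProbabilityMeasure (streamsLaw l m) := isProbabilityMeasure_streamsLaw hl
  have hprob' : IsProbabilityMeasure (customerLaw l m) := isProbabilityMeasure_customerLaw hl
  have hexp := isProbabilityMeasure_expMeasure (sum_rate_pos hl)
  have hG := measurable_queueStep hB
  have hcQ : customerLaw l m Q = c := by
    have h := congrArg (fun μ : Measure ℝ => μ Set.univ) hc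
    simpa [Measure.map_apply hB] using h
  have hfQ : MeasurableSet {p : ℝ × (ι → ℕ → ℝ × ℝ) | (firstCustomer p.2).2 ∈ Q} :=
    (measurable_firstCustomer.comp measurable_snd).snd hQ
  choose β hβ using fun k => exists_map_iterate_queueStep_restrict hl hκ hσ hB hQ hc hc' k n
  let S : ℕ → Set (ℝ × (ι → ℕ → ℝ × ℝ)) := fun k =>
    {p | countMark Q k p.2 = n} ∩ {p | (nthCustomer k p.2).2 ∈ Q}
  have hCm : ∀ k, MeasurableSet {p : ℝ × (ι → ℕ → ℝ × ℝ) | countMark Q k p.2 = n} := fun k =>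
    ((measurable_countMark hQ k).comp measurable_snd) (measurableSet_singleton n)
  have hSm : ∀ k, MeasurableSet (S k) := fun k =>
    (hCm k).inter (((measurable_nthCustomer k).comp measurable_snd).snd hQ)
  have hinf : ∀ᵐ p ∂σ.prod (streamsLaw l m), {k | (nthCustomer k p.2).2 ∈ Q}.Infinite :=
    Measure.quasiMeasurePreserving_snd.ae (ae_infinite_mark hl hQ (by rw [hcQ]; exact hc0))
  -- Decompose over the value `k` of the random index. Each term is `β k` times a stationary
  -- probability, so the dependence on `D` factors out as `q`.
  have hgen : ∀ (D : Set (ℝ × (ι → ℕ → ℝ × ℝ))) (_ : MeasurableSet D) (q : ℝ≥0∞)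
      (_ : (σ.prod (streamsLaw l m)) ({p | (firstCustomer p.2).2 ∈ Q} ∩ D) = c * q),
      (σ.prod (streamsLaw l m)) {p | (queueStep B)^[markIndex Q n p.2] p ∈ D} =
        (∑' k, β k * c) * q := by
    intro D hD q hq
    have hae : {p | (queueStep B)^[markIndex Q n p.2] p ∈ D} =ᵐ[σ.prod (streamsLaw l m)]
        ⋃ k, S k ∩ (queueStep B)^[k] ⁻¹' D := by
      filter_upwards [hinf] with p hp
      refine propext ⟨fun h => ?_, fun h => ?_⟩
      · obtain ⟨h1, h2⟩ := countMark_markIndex (Q := Q) (n := n) (x := p.2)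
          fun hf => absurd hf hp
        exact Set.mem_iUnion.2 ⟨markIndex Q n p.2, ⟨h1, h2⟩, h⟩
      · obtain ⟨k, ⟨h1, h2⟩, h3⟩ := Set.mem_iUnion.1 h
        change (queueStep B)^[markIndex Q n p.2] p ∈ D
        rw [markIndex_eq h1 h2]
        exact h3
    have hdisj : Pairwise (Function.onFun Disjoint fun k => S k ∩ (queueStep B)^[k] ⁻¹' D) := by
      intro j k hjk
      refine Set.disjoint_left.2 fun p hp hp' => hjk ?_
      rw [← markIndex_eq hp.1.1 hp.1.2, markIndex_eq hp'.1.1 hp'.1.2]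
    rw [measure_congr hae, measure_iUnion hdisj fun k => (hSm k).inter ((hG.iterate k) hD),
      ← ENNReal.tsum_mul_right]
    refine tsum_congr fun k => ?_
    have h1 : S k ∩ (queueStep B)^[k] ⁻¹' D =
        ((queueStep B)^[k] ⁻¹' ({p | (firstCustomer p.2).2 ∈ Q} ∩ D)) ∩
          {p | countMark Q k p.2 = n} := by
      ext p
      simp only [S, Set.mem_inter_iff, Set.mem_preimage, Set.mem_ofPred_eq,
        iterate_queueStep_snd, nthCustomer]
      tauto
    rw [h1, ← Measure.restrict_apply ((hG.iterate k) (hfQ.inter hD)),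
      ← Measure.map_apply (hG.iterate k) (hfQ.inter hD), hβ, Measure.smul_apply, hq, smul_eq_mul,
      mul_assoc]
  -- The whole space identifies the common constant as `1`, without computing any `β k`.
  have h1 := hgen Set.univ .univ 1 (by
    rw [Set.inter_univ, mul_one]
    have hmp := (measurePreserving_firstCustomer (m := m) hl).comp
      (measurePreserving_snd (μ := σ) (ν := streamsLaw l m))
    have := hmp.measure_preimage (measurable_snd hQ).nullMeasurableSet
    refine this.trans ?_
    rw [← Set.univ_prod, Measure.prod_prod, measure_univ, one_mul, hcQ])
  rw [hgen D hD q hq]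
  simp only [Set.mem_univ, mul_one] at h1
  rw [← h1]
  simp

end Queue

/-! ### The stationary law of one queue and the coupling of initial works -/

section Queue

open scoped ENNReal

variable {ι : Type*} [Fintype ι] [Nonempty ι] [DecidableEq ι]

/-- The work brought by a customer to the queue serving the streams in `K`. -/
noncomputable def workFor (K : Finset ι) (z : ι × ℝ) : ℝ := if z.1 ∈ K then z.2 else 0

variable [MeasurableSpace ι] [DiscreteMeasurableSpace ι]

omit [Fintype ι] [Nonempty ι] [DecidableEq ι] in
theorem measurableSet_fst_mem (O : Finset ι) : MeasurableSet {z : ι × ℝ | z.1 ∈ O} :=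
  measurable_fst (MeasurableSet.of_discrete (s := (O : Set ι)))

omit [Fintype ι] [Nonempty ι] in
theorem measurable_workFor (K : Finset ι) : Measurable (workFor K) :=
  Measurable.ite (measurableSet_fst_mem K) measurable_snd measurable_const

variable {l : ι → ℝ} {m : ι → Measure ℝ} [∀ i, IsProbabilityMeasure (m i)]
  {K : Finset ι} {μ : ℝ}

omit [∀ i, IsProbabilityMeasure (m i)] [MeasurableSpace ι] [DiscreteMeasurableSpace ι] in
theorem sum_inter_compl (O : Finset ι)
    (hO : ∑ i ∈ O ∩ K, l i = (∑ i ∈ K, l i) / (∑ i, l i) * ∑ i ∈ O, l i) (hl : ∀ i, 0 < l i) :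
    ∑ i ∈ Oᶜ ∩ K, l i = (∑ i ∈ K, l i) / (∑ i, l i) * ∑ i ∈ Oᶜ, l i := by
  have hpos := sum_rate_pos hl
  have h1 : Oᶜ ∩ K = K \ O := by ext i; simp [and_comm]
  have h2 := Finset.sum_inter_add_sum_sdiff K O l
  have h3 := Finset.sum_add_sum_compl O l
  rw [Finset.inter_comm, hO] at h2
  rw [h1, eq_sub_of_add_eq' h2, eq_sub_of_add_eq' h3]
  field_simp

/-- By `hO` a customer of `O` joins the queue with the same probability as an arbitrary customer, so
membership in `O` changes only the total mass of the law of the work brought. -/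
theorem map_workFor_restrict (hl : ∀ i, 0 < l i) (hμ : 0 < μ)
    (hm : ∀ i ∈ K, m i = expMeasure μ) (O : Finset ι)
    (hO : ∑ i ∈ O ∩ K, l i = (∑ i ∈ K, l i) / (∑ i, l i) * ∑ i ∈ O, l i) :
    ((customerLaw l m).restrict {z | z.1 ∈ O}).map (workFor K) =
      ENNReal.ofReal ((∑ i ∈ O, l i) / ∑ i, l i) •
        expOrZero ((∑ i ∈ K, l i) / ∑ i, l i) μ := by
  have hexp := isProbabilityMeasure_expMeasure hμ
  have hpos := sum_rate_pos hl
  refine Measure.ext_of_lintegral _ fun f hf => ?_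
  have hfB : Measurable fun z => f (workFor K z) := hf.comp (measurable_workFor K)
  rw [lintegral_map hf (measurable_workFor K), ← lintegral_indicator (measurableSet_fst_mem O),
    lintegral_customerLaw (hfB.indicator (measurableSet_fst_mem O)), expOrZero,
    lintegral_smul_measure, lintegral_add_measure, lintegral_smul_measure, lintegral_smul_measure,
    lintegral_dirac' _ hf]
  simp only [smul_eq_mul]
  have hterm : ∀ i, ENNReal.ofReal (l i / ∑ j, l j) *
      ∫⁻ s, {z : ι × ℝ | z.1 ∈ O}.indicator (fun z => f (workFor K z)) (i, s) ∂m i =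
      if i ∈ O then (ENNReal.ofReal (l i / ∑ j, l j) *
        if i ∈ K then ∫⁻ x, f x ∂expMeasure μ else f 0) else 0 := by
    intro i
    by_cases hi : i ∈ O
    · simp only [Set.indicator, Set.mem_ofPred_eq, hi, if_true, workFor]
      by_cases hk : i ∈ K
      · simp only [hk, if_true, hm i hk]
      · simp [hk]
    · simp [Set.indicator, hi]
  have hs : ∀ T : Finset ι, ∑ i ∈ T, ENNReal.ofReal (l i / ∑ j, l j) =
      ENNReal.ofReal ((∑ i ∈ T, l i) / ∑ j, l j) := fun T => by
    rw [← ENNReal.ofReal_sum_of_nonneg fun i _ => div_nonneg (hl i).le hpos.le, Finset.sum_div]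
  have hKle : ∑ i ∈ K, l i ≤ ∑ i, l i :=
    Finset.sum_le_sum_of_subset_of_nonneg (Finset.subset_univ K) fun i _ _ => (hl i).le
  have hO0 : 0 ≤ ∑ i ∈ O, l i := Finset.sum_nonneg fun i _ => (hl i).le
  have hK0 : 0 ≤ ∑ i ∈ K, l i := Finset.sum_nonneg fun i _ => (hl i).le
  have hsplit : ∑ i ∈ O \ K, l i = ∑ i ∈ O, l i - ∑ i ∈ O ∩ K, l i := by
    rw [← Finset.sum_inter_add_sum_sdiff O K]; ring
  rw [Finset.sum_congr rfl fun i _ => hterm i, Finset.sum_ite_mem, Finset.univ_inter,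
    ← Finset.sum_inter_add_sum_sdiff O K,
    Finset.sum_congr rfl fun i hi => by rw [if_pos (Finset.mem_inter.1 hi).2],
    Finset.sum_congr (s₁ := O \ K) rfl fun i hi => by rw [if_neg (Finset.mem_sdiff.1 hi).2],
    ← Finset.sum_mul, ← Finset.sum_mul, hs, hs, hsplit, mul_add, ← mul_assoc, ← mul_assoc,
    ← ENNReal.ofReal_mul (div_nonneg hO0 hpos.le), ← ENNReal.ofReal_mul (div_nonneg hO0 hpos.le),
    add_comm, hO]
  congr 3
  · field_simp
  · field_simp

/-- The work found is independent of the mark, and on joining the queue the service time is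
exponential; the factorisation between `O` and `K` is `hO`. -/
theorem measure_firstCustomer_remainingWork (hl : ∀ i, 0 < l i)
    (hm : ∀ i ∈ K, m i = expMeasure μ) {σ κ τ : Measure ℝ}
    [IsProbabilityMeasure σ] [IsProbabilityMeasure κ] [IsProbabilityMeasure (expMeasure μ)]
    (hκ : (σ.prod (expMeasure (∑ i, l i))).map (fun p => max (p.1 - p.2) 0) = κ)
    (hτ : κ.conv (expMeasure μ) = τ) (O : Finset ι)
    (hO : ∑ i ∈ O ∩ K, l i = (∑ i ∈ K, l i) / (∑ i, l i) * ∑ i ∈ O, l i) {A : Set ℝ}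
    (hA : MeasurableSet A) :
    (σ.prod (streamsLaw l m)) ({p | (firstCustomer p.2).2 ∈ {z : ι × ℝ | z.1 ∈ O}} ∩
      {p | firstStream p.2 ∈ K ∧ remainingWork p + (firstCustomer p.2).2.2 ∈ A}) =
      ENNReal.ofReal ((∑ i ∈ O, l i) / ∑ i, l i) *
        (ENNReal.ofReal ((∑ i ∈ K, l i) / ∑ i, l i) * τ A) := by
  have hprob : IsProbabilityMeasure (streamsLaw l m) := isProbabilityMeasure_streamsLaw hl
  have hprob' : IsProbabilityMeasure (customerLaw l m) := isProbabilityMeasure_customerLaw hl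
  have hpos := sum_rate_pos hl
  have hH : Measurable fun p : ℝ × (ι → ℕ → ℝ × ℝ) =>
      (remainingWork p, (firstCustomer p.2).2, shiftStreams p.2) :=
    measurable_remainingWork.prodMk ((measurable_firstCustomer.comp measurable_snd).snd.prodMk
      (measurable_shiftStreams.comp measurable_snd))
  let E : Set (ℝ × (ι × ℝ)) := {q | q.2.1 ∈ O ∩ K ∧ q.1 + q.2.2 ∈ A}
  have hE : MeasurableSet E := by
    refine MeasurableSet.inter ?_ ?_
    · exact measurable_snd (measurableSet_fst_mem (O ∩ K))
    · exact (measurable_fst.add measurable_snd.snd) hA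
  have hproj : Measurable fun q : ℝ × (ι × ℝ) × (ι → ℕ → ℝ × ℝ) => (q.1, q.2.1) := by fun_prop
  have hset : ({p | (firstCustomer p.2).2 ∈ {z : ι × ℝ | z.1 ∈ O}} ∩
      {p : ℝ × (ι → ℕ → ℝ × ℝ) | firstStream p.2 ∈ K ∧
        remainingWork p + (firstCustomer p.2).2.2 ∈ A}) =
      (fun p => (remainingWork p, (firstCustomer p.2).2, shiftStreams p.2)) ⁻¹'
        ((fun q : ℝ × (ι × ℝ) × (ι → ℕ → ℝ × ℝ) => (q.1, q.2.1)) ⁻¹' E) := by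
    ext p
    simp only [E, Set.mem_inter_iff, Set.mem_ofPred_eq, Set.mem_preimage, Finset.mem_inter,
      firstCustomer]
    tauto
  have hmarg : (κ.prod ((customerLaw l m).prod (streamsLaw l m))).map
      (fun q : ℝ × (ι × ℝ) × (ι → ℕ → ℝ × ℝ) => (q.1, q.2.1)) = κ.prod (customerLaw l m) := by
    have := Measure.map_prod_map κ ((customerLaw l m).prod (streamsLaw l m)) measurable_id
      measurable_fst
    rw [Measure.map_fst_prod, measure_univ, one_smul, Measure.map_id] at this
    exact this.symm
  rw [hset, ← Measure.map_apply hH (hproj hE), map_remainingWork_prod hl hκ,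
    ← Measure.map_apply hproj hE, hmarg, ← lintegral_indicator_one hE,
    lintegral_prod _ (measurable_one.indicator hE).aemeasurable]
  have hinner : ∀ w, ∫⁻ z, E.indicator (1 : ℝ × (ι × ℝ) → ℝ≥0∞) (w, z) ∂customerLaw l m =
      ENNReal.ofReal ((∑ i ∈ O ∩ K, l i) / ∑ i, l i) *
        ∫⁻ s, A.indicator 1 (w + s) ∂expMeasure μ := by
    intro w
    have hEw : Measurable fun z => E.indicator (1 : ℝ × (ι × ℝ) → ℝ≥0∞) (w, z) :=
      (measurable_one.indicator hE).comp measurable_prodMk_left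
    rw [lintegral_customerLaw hEw,
      Finset.sum_div, ENNReal.ofReal_sum_of_nonneg fun i _ => div_nonneg (hl i).le hpos.le,
      Finset.sum_mul, ← Finset.univ_inter (O ∩ K), ← Finset.sum_ite_mem]
    refine Finset.sum_congr rfl fun i _ => ?_
    by_cases hi : i ∈ O ∩ K
    · rw [if_pos hi, hm i (Finset.mem_inter.1 hi).2]
      congr 1
      refine lintegral_congr fun s => ?_
      by_cases hs : w + s ∈ A
      · rw [Set.indicator_of_mem hs, Set.indicator_of_mem (show (w, (i, s)) ∈ E from ⟨hi, hs⟩)]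
        rfl
      · rw [Set.indicator_of_notMem hs,
          Set.indicator_of_notMem (show (w, (i, s)) ∉ E from fun h => hs h.2)]
    · rw [if_neg hi]
      have : ∀ s, E.indicator (1 : ℝ × (ι × ℝ) → ℝ≥0∞) (w, (i, s)) = 0 := fun s =>
        Set.indicator_of_notMem (fun h => hi h.1) _
      simp [this]
  simp_rw [hinner]
  have hAm : Measurable (A.indicator (1 : ℝ → ℝ≥0∞)) := measurable_one.indicator hA
  have hmeas : Measurable fun w => ∫⁻ s, A.indicator (1 : ℝ → ℝ≥0∞) (w + s) ∂expMeasure μ := by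
    have : Measurable fun p : ℝ × ℝ => A.indicator (1 : ℝ → ℝ≥0∞) (p.1 + p.2) :=
      hAm.comp (by fun_prop)
    exact this.lintegral_prod_right'
  rw [lintegral_const_mul _ hmeas, ← Measure.lintegral_conv hAm, hτ, lintegral_indicator_one hA,
    ← mul_assoc, ← ENNReal.ofReal_mul (div_nonneg (Finset.sum_nonneg fun i _ => (hl i).le)
      hpos.le), hO]
  congr 2
  field_simp

/-- In stationarity, the probability that the `n`-th customer of the streams in `O` joins a given
queue and has its sojourn time in `A`. -/
theorem stationary_sojourn_law (hl : ∀ i, 0 < l i) (hK : ∑ i ∈ K, l i < μ)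
    (hm : ∀ i ∈ K, m i = expMeasure μ) (O : Finset ι) (hO0 : O.Nonempty)
    (hO : ∑ i ∈ O ∩ K, l i = (∑ i ∈ K, l i) / (∑ i, l i) * ∑ i ∈ O, l i) :
    ∃ σ : Measure ℝ, IsProbabilityMeasure σ ∧ ∀ (n : ℕ) (A : Set ℝ), MeasurableSet A →
      (σ.prod (streamsLaw l m)) {p | (queueStep (workFor K))^[markIndex {z | z.1 ∈ O} n p.2] p ∈
        {p | firstStream p.2 ∈ K ∧ remainingWork p + (firstCustomer p.2).2.2 ∈ A}} =
      ENNReal.ofReal ((∑ i ∈ K, l i) / ∑ i, l i) * expMeasure (μ - ∑ i ∈ K, l i) A := by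
  have hpos := sum_rate_pos hl
  have hK0 : 0 ≤ ∑ i ∈ K, l i := Finset.sum_nonneg fun i _ => (hl i).le
  have hKle : ∑ i ∈ K, l i ≤ ∑ i, l i :=
    Finset.sum_le_sum_of_subset_of_nonneg (Finset.subset_univ K) fun i _ _ => (hl i).le
  have hμ : 0 < μ := hK0.trans_lt hK
  have hexp := isProbabilityMeasure_expMeasure hμ
  set p : ℝ := (∑ i ∈ K, l i) / ∑ i, l i with hp
  have hp0 : 0 ≤ p := div_nonneg hK0 hpos.le
  have hp1 : p ≤ 1 := by rw [hp, div_le_one hpos]; exact hKle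
  set θ : ℝ := μ - ∑ i ∈ K, l i with hθ
  have hθ0 : 0 < θ := by linarith
  have hθμ : θ ≤ μ := by linarith
  set ρ : ℝ := (μ - θ) / μ with hρ
  have hρ0 : 0 ≤ ρ := div_nonneg (by linarith) hμ.le
  have hρ1 : ρ ≤ 1 := by rw [hρ, div_le_one hμ]; linarith
  have hβ0 : 0 ≤ (1 - p) * ρ + p := add_nonneg (mul_nonneg (by linarith) hρ0) hp0
  have hβ1 : (1 - p) * ρ + p ≤ 1 := by nlinarith
  have hσP := isProbabilityMeasure_expOrZero hβ0 hβ1 hθ0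
  have hκP := isProbabilityMeasure_expOrZero hρ0 hρ1 hθ0
  have hbP := isProbabilityMeasure_expOrZero hp0 hp1 hμ
  -- The balance equation that fixes `ρ`: with `L` the total rate it reduces to `L p (1 - ρ) = ρ θ`,
  -- and both sides equal `(∑ i ∈ K, l i) θ / μ`.
  have hκ : ((expOrZero ((1 - p) * ρ + p) θ).prod (expMeasure (∑ i, l i))).map
      (fun p => max (p.1 - p.2) 0) = expOrZero ρ θ := by
    rw [map_max_sub_expOrZero_prod hβ0 hβ1 hθ0 hpos]
    congr 1
    have hne : (∑ i, l i) + θ ≠ 0 := by positivity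
    rw [div_eq_iff hne, hρ, hp]
    field_simp
    rw [hθ]
    ring
  have hσ : (expOrZero ρ θ).conv (expOrZero p μ) = expOrZero ((1 - p) * ρ + p) θ :=
    expOrZero_conv_expOrZero hp0 hp1 hθ0 hθμ
  refine ⟨expOrZero ((1 - p) * ρ + p) θ, hσP, fun n A hA => ?_⟩
  have hcompl : {z : ι × ℝ | z.1 ∈ O}ᶜ = {z : ι × ℝ | z.1 ∈ Oᶜ} := by ext z; simp
  refine measure_iterate_queueStep_markIndex hl hκ hσ (measurable_workFor K)
    (measurableSet_fst_mem O) (map_workFor_restrict hl hμ hm O hO)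
    (c' := ENNReal.ofReal ((∑ i ∈ Oᶜ, l i) / ∑ i, l i)) ?_ ?_ n ?_ ?_
  · rw [hcompl]
    exact map_workFor_restrict hl hμ hm Oᶜ (sum_inter_compl O hO hl)
  · have : 0 < ∑ i ∈ O, l i := Finset.sum_pos (fun i _ => hl i) hO0
    simpa using div_pos this hpos
  · refine MeasurableSet.inter ?_ ?_
    · exact (measurable_firstStream.comp measurable_snd) (MeasurableSet.of_discrete (s := (K : Set ι)))
    · exact (measurable_remainingWork.add
        (measurable_firstCustomer.comp measurable_snd).snd.snd) hA
  · exact measure_firstCustomer_remainingWork hl hm hκ (expOrZero_conv_expMeasure hθ0 hθμ) O hO hA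

/-- The remaining works found by the successive customers for two initial works eventually agree. -/
theorem ae_eventually_remainingWork_eq (hl : ∀ i, 0 < l i) (hK : ∑ i ∈ K, l i < μ)
    (hm : ∀ i ∈ K, m i = expMeasure μ) :
    ∀ᵐ x ∂streamsLaw l m, ∀ y y' : ℝ, ∀ᶠ n in atTop,
      remainingWork ((queueStep (workFor K))^[n] (y, x)) =
        remainingWork ((queueStep (workFor K))^[n] (y', x)) := by
  have hprob' : IsProbabilityMeasure (customerLaw l m) := isProbabilityMeasure_customerLaw hl
  have hpos := sum_rate_pos hl
  have hexp := isProbabilityMeasure_expMeasure hpos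
  have hK0 : 0 ≤ ∑ i ∈ K, l i := Finset.sum_nonneg fun i _ => (hl i).le
  have hKle : ∑ i ∈ K, l i ≤ ∑ i, l i :=
    Finset.sum_le_sum_of_subset_of_nonneg (Finset.subset_univ K) fun i _ _ => (hl i).le
  have hμ : 0 < μ := hK0.trans_lt hK
  have hexpμ := isProbabilityMeasure_expMeasure hμ
  have hp0 : 0 ≤ (∑ i ∈ K, l i) / ∑ i, l i := div_nonneg hK0 hpos.le
  have hp1 : (∑ i ∈ K, l i) / ∑ i, l i ≤ 1 := by rw [div_le_one hpos]; exact hKle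
  have hlaw : (customerLaw l m).map (workFor K) =
      expOrZero ((∑ i ∈ K, l i) / ∑ i, l i) μ := by
    have := map_workFor_restrict hl hμ hm Finset.univ (by
      rw [Finset.univ_inter, div_mul_cancel₀ _ hpos.ne'])
    simpa [div_self hpos.ne'] using this
  have hintB : Integrable (fun x : ℝ => x) (expOrZero ((∑ i ∈ K, l i) / ∑ i, l i) μ) := by
    refine Integrable.add_measure ?_ ?_
    · exact (integrable_dirac (by simp)).smul_measure ENNReal.ofReal_ne_top
    · exact (integrable_id_expMeasure hμ).smul_measure ENNReal.ofReal_ne_top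
  have hEB : ∫ x, x ∂expOrZero ((∑ i ∈ K, l i) / ∑ i, l i) μ =
      (∑ i ∈ K, l i) / (∑ i, l i) / μ := by
    rw [expOrZero, integral_add_measure
      ((integrable_dirac (by simp)).smul_measure ENNReal.ofReal_ne_top)
      ((integrable_id_expMeasure hμ).smul_measure ENNReal.ofReal_ne_top),
      integral_smul_measure, integral_smul_measure, integral_dirac, integral_id_expMeasure hμ,
      ENNReal.toReal_ofReal hp0]
    simp [div_eq_mul_inv]
  have hBm := measurable_workFor K
  have hmpB : MeasurePreserving (workFor K) (customerLaw l m)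
      (expOrZero ((∑ i ∈ K, l i) / ∑ i, l i) μ) := ⟨hBm, hlaw⟩
  have hmpB' := hmpB.comp (measurePreserving_snd (μ := expMeasure (∑ i, l i))
    (ν := customerLaw l m))
  have hmpD := measurePreserving_fst (μ := expMeasure (∑ i, l i)) (ν := customerLaw l m)
  have hb := strong_law_nthCustomer (m := m) hl (h := fun z => workFor K z.2) hmpB'.measurable
    (hmpB'.integrable_comp_of_integrable hintB)
  have hd := strong_law_nthCustomer (m := m) hl (h := fun z => z.1) measurable_fst
    (hmpD.integrable_comp_of_integrable (integrable_id_expMeasure hpos))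
  have hib : ∫ z, workFor K z.2 ∂(expMeasure (∑ i, l i)).prod (customerLaw l m) =
      (∑ i ∈ K, l i) / (∑ i, l i) / μ := by
    rw [← hEB, ← hmpB'.map_eq, integral_map hmpB'.measurable.aemeasurable (by fun_prop)]
    rfl
  have hid : ∫ z, z.1 ∂(expMeasure (∑ i, l i)).prod (customerLaw l m) = 1 / ∑ i, l i := by
    rw [← integral_id_expMeasure hpos]
    conv_rhs => rw [← hmpD.map_eq, integral_map hmpD.measurable.aemeasurable (by fun_prop)]
  -- The null set comes from the two strong laws alone, so one path serves all pairs of initial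
  -- works. This allows an initial work that depends on the path.
  filter_upwards [hb, hd] with x hbx hdx y y'
  rw [hib] at hbx
  rw [hid] at hdx
  -- Stability per customer of the whole system: mean work brought against mean gap.
  have hlt : (∑ i ∈ K, l i) / (∑ i, l i) / μ < 1 / ∑ i, l i := by
    rw [div_div, div_lt_div_iff₀ (by positivity) hpos]
    nlinarith
  have hrec : ∀ (y : ℝ) (n : ℕ), ((queueStep (workFor K))^[n + 1] (y, x)).1 =
      max (((queueStep (workFor K))^[n] (y, x)).1 - (nthCustomer n x).1) 0 +
        workFor K (nthCustomer n x).2 := by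
    intro y n
    rw [Function.iterate_succ_apply']
    change max (((queueStep (workFor K))^[n] (y, x)).1 -
      (firstCustomer ((queueStep (workFor K))^[n] (y, x)).2).1) 0 +
      workFor K (firstCustomer ((queueStep (workFor K))^[n] (y, x)).2).2 = _
    rw [iterate_queueStep_snd]
    rfl
  have hc := lindley_coupling (Y := fun n => ((queueStep (workFor K))^[n] (y, x)).1)
    (Y' := fun n => ((queueStep (workFor K))^[n] (y', x)).1) (hrec y) (hrec y') hbx hdx hlt
  filter_upwards [hc] with n hn
  simp only [remainingWork, iterate_queueStep_snd]
  exact hn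

end Queue

/-! ### Convergence from an arbitrary initial work -/

section Queue

open scoped ENNReal

variable {ι : Type*} [Fintype ι] [Nonempty ι] [DecidableEq ι]

/-- The paths of the input, started from given initial work, for which the `n`-th customer of the
streams in `O` is served with the streams in `K` and has its sojourn time in `A`. -/
def sojournEvent (K O : Finset ι) (n : ℕ) (A : Set ℝ) : Set (ℝ × (ι → ℕ → ℝ × ℝ)) :=
  {p | (queueStep (workFor K))^[markIndex {z | z.1 ∈ O} n p.2] p ∈
    {p | firstStream p.2 ∈ K ∧ remainingWork p + (firstCustomer p.2).2.2 ∈ A}}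

theorem sojournEvent_iff {K O : Finset ι} {n : ℕ} {A : Set ℝ} {y y' : ℝ} {x : ι → ℕ → ℝ × ℝ}
    (h : remainingWork ((queueStep (workFor K))^[markIndex {z | z.1 ∈ O} n x] (y, x)) =
      remainingWork ((queueStep (workFor K))^[markIndex {z | z.1 ∈ O} n x] (y', x))) :
    (y, x) ∈ sojournEvent K O n A ↔ (y', x) ∈ sojournEvent K O n A := by
  simp only [sojournEvent, Set.mem_ofPred_eq, iterate_queueStep_snd, h]

variable [MeasurableSpace ι] [DiscreteMeasurableSpace ι]

theorem measurableSet_sojournEvent (K O : Finset ι) (n : ℕ) {A : Set ℝ} (hA : MeasurableSet A) :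
    MeasurableSet (sojournEvent K O n A) := by
  have hD : MeasurableSet {p : ℝ × (ι → ℕ → ℝ × ℝ) | firstStream p.2 ∈ K ∧
      remainingWork p + (firstCustomer p.2).2.2 ∈ A} := by
    refine MeasurableSet.inter ?_ ?_
    · exact (measurable_firstStream.comp measurable_snd)
        (MeasurableSet.of_discrete (s := (K : Set ι)))
    · exact (measurable_remainingWork.add
        (measurable_firstCustomer.comp measurable_snd).snd.snd) hA
  have hG : Measurable fun q : ℕ × (ℝ × (ι → ℕ → ℝ × ℝ)) => (queueStep (workFor K))^[q.1] q.2 :=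
    measurable_from_prod_countable_right fun k =>
      (measurable_queueStep (measurable_workFor K)).iterate k
  exact (hG.comp (((measurable_markIndex (measurableSet_fst_mem O) n).comp
    measurable_snd).prodMk measurable_id)) hD

variable {l : ι → ℝ} {m : ι → Measure ℝ} [∀ i, IsProbabilityMeasure (m i)]
  {K : Finset ι} {μ : ℝ}

omit [DecidableEq ι] in
theorem customerLaw_fst_mem_ne_zero (hl : ∀ i, 0 < l i) {O : Finset ι} (hO : O.Nonempty) :
    customerLaw l m {z | z.1 ∈ O} ≠ 0 := by
  obtain ⟨i, hi⟩ := hO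
  rw [customerLaw, Measure.finsetSum_apply]
  intro h
  have h := (Finset.sum_eq_zero_iff.1 h) i (Finset.mem_univ i)
  rw [Measure.smul_apply, Measure.map_apply (by fun_prop) (measurableSet_fst_mem O)] at h
  have : Prod.mk i ⁻¹' {z : ι × ℝ | z.1 ∈ O} = Set.univ := by ext s; simp [hi]
  rw [this, measure_univ, smul_eq_mul, mul_one, ENNReal.ofReal_eq_zero] at h
  exact absurd h (not_le.2 (div_pos (hl i) (sum_rate_pos hl)))

/-- For an arbitrary initial work, the sojourn times of the customers of the streams in `O`
converge in law along each queue. -/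
theorem tendsto_measure_sojournEvent (hl : ∀ i, 0 < l i) (hK : ∑ i ∈ K, l i < μ)
    (hm : ∀ i ∈ K, m i = expMeasure μ) (O : Finset ι) (hO0 : O.Nonempty)
    (hO : ∑ i ∈ O ∩ K, l i = (∑ i ∈ K, l i) / (∑ i, l i) * ∑ i ∈ O, l i)
    {η : Measure (ℝ × (ι → ℕ → ℝ × ℝ))} [IsProbabilityMeasure η]
    (hη : η.map Prod.snd = streamsLaw l m) {A : Set ℝ} (hA : MeasurableSet A) :
    Tendsto (fun n => η.real (sojournEvent K O n A)) atTop
      (𝓝 ((∑ i ∈ K, l i) / (∑ i, l i) * (expMeasure (μ - ∑ i ∈ K, l i)).real A)) := by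
  have hprob : IsProbabilityMeasure (streamsLaw l m) := isProbabilityMeasure_streamsLaw hl
  obtain ⟨σ, hσP, hσ⟩ := stationary_sojourn_law hl hK hm O hO0 hO
  have hS := fun n => measurableSet_sojournEvent K O n hA
  have hmpsnd : MeasurePreserving Prod.snd η (streamsLaw l m) := ⟨measurable_snd, hη⟩
  -- An independent stationary initial work is adjoined and the path is shared. Only the path
  -- marginal of `η` enters, so its two components may be dependent.
  have hmp : MeasurePreserving (fun q : (ℝ × (ι → ℕ → ℝ × ℝ)) × ℝ => (q.2, q.1.2)) (η.prod σ)
      (σ.prod (streamsLaw l m)) :=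
    (Measure.measurePreserving_swap (μ := streamsLaw l m) (ν := σ)).comp
      (hmpsnd.prod (MeasurePreserving.id σ))
  have h1 : ∀ n, (η.prod σ).real (Prod.fst ⁻¹' sojournEvent K O n A) =
      η.real (sojournEvent K O n A) := fun n => by
    rw [measureReal_def, measurePreserving_fst.measure_preimage (hS n).nullMeasurableSet]; rfl
  have h2 : ∀ n, (η.prod σ).real ((fun q : (ℝ × (ι → ℕ → ℝ × ℝ)) × ℝ => (q.2, q.1.2)) ⁻¹'
      sojournEvent K O n A) =
      (∑ i ∈ K, l i) / (∑ i, l i) * (expMeasure (μ - ∑ i ∈ K, l i)).real A := fun n => by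
    rw [measureReal_def, hmp.measure_preimage (hS n).nullMeasurableSet, sojournEvent, hσ n A hA,
      ENNReal.toReal_mul, ENNReal.toReal_ofReal]
    · rfl
    · exact div_nonneg (Finset.sum_nonneg fun i _ => (hl i).le) (sum_rate_pos hl).le
  have hF1 : ∀ n, MeasurableSet ((Prod.fst ⁻¹' sojournEvent K O n A :
      Set ((ℝ × (ι → ℕ → ℝ × ℝ)) × ℝ))) := fun n => measurable_fst (hS n)
  have hF2 : ∀ n, MeasurableSet ((fun q : (ℝ × (ι → ℕ → ℝ × ℝ)) × ℝ => (q.2, q.1.2)) ⁻¹'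
      sojournEvent K O n A) := fun n => hmp.measurable (hS n)
  -- Almost surely the two systems disagree about the event for only finitely many `n`; dominated
  -- convergence makes the probability of disagreement vanish.
  have hsymm : Tendsto (fun n => (η.prod σ) (symmDiff (Prod.fst ⁻¹' sojournEvent K O n A)
      ((fun q : (ℝ × (ι → ℕ → ℝ × ℝ)) × ℝ => (q.2, q.1.2)) ⁻¹' sojournEvent K O n A))) atTop
      (𝓝 ((η.prod σ) ∅)) := by
    refine tendsto_measure_of_ae_tendsto_indicator_of_isFiniteMeasure atTop .empty
      (fun n => (hF1 n).symmDiff (hF2 n)) ?_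
    have hx : ∀ᵐ q ∂η.prod σ, (∀ y y' : ℝ, ∀ᶠ n in atTop,
      remainingWork ((queueStep (workFor K))^[n] (y, q.1.2)) =
        remainingWork ((queueStep (workFor K))^[n] (y', q.1.2))) ∧
        {k | (nthCustomer k q.1.2).2 ∈ {z : ι × ℝ | z.1 ∈ O}}.Infinite := by
      have hx0 := (ae_eventually_remainingWork_eq hl hK hm).and
        (ae_infinite_mark hl (measurableSet_fst_mem O) (customerLaw_fst_mem_ne_zero hl hO0))
      have hx1 : ∀ᵐ p ∂σ.prod (streamsLaw l m), _ := Measure.quasiMeasurePreserving_snd.ae hx0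
      exact hmp.quasiMeasurePreserving.ae hx1
    filter_upwards [hx] with q hq
    have hJ : Tendsto (fun n => markIndex {z : ι × ℝ | z.1 ∈ O} n q.1.2) atTop atTop :=
      (Nat.nth_strictMono hq.2).tendsto_atTop
    filter_upwards [hJ.eventually (hq.1 q.1.1 q.2)] with n hn
    have := sojournEvent_iff (A := A) hn
    simp only [Set.mem_symmDiff, Set.mem_preimage, Set.mem_empty_iff_false, iff_false]
    tauto
  rw [measure_empty] at hsymm
  have hsymm' : Tendsto (fun n => (η.prod σ).real (symmDiff (Prod.fst ⁻¹' sojournEvent K O n A)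
      ((fun q : (ℝ × (ι → ℕ → ℝ × ℝ)) × ℝ => (q.2, q.1.2)) ⁻¹' sojournEvent K O n A))) atTop
      (𝓝 0) := (ENNReal.tendsto_toReal ENNReal.zero_ne_top).comp hsymm
  rw [tendsto_iff_dist_tendsto_zero]
  refine squeeze_zero (fun n => dist_nonneg) (fun n => ?_) hsymm'
  rw [Real.dist_eq, ← h1 n, ← h2 n]
  exact abs_measureReal_sub_le_measureReal_symmDiff (hF1 n).nullMeasurableSet (hF2 n).nullMeasurableSet

end Queue

/-! ### The service system in terms of its input path -/

namespace ServiceSystem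

variable {A R : Type*} [Fintype A] [Fintype R]

noncomputable instance (S : ServiceSystem A R) : Fintype S.Stream := Fintype.ofFinite _

noncomputable instance (S : ServiceSystem A R) : DecidableEq S.Stream := Classical.decEq _

instance (S : ServiceSystem A R) : MeasurableSpace S.Stream := ⊤

instance (S : ServiceSystem A R) : DiscreteMeasurableSpace S.Stream := ⟨fun _ => trivial⟩

/-- The arrival rate of a stream. -/
def streamRate (S : ServiceSystem A R) (i : S.Stream) : ℝ := S.rate i.origin i.regime

/-- The service time law of a stream. -/
noncomputable def streamService (S : ServiceSystem A R) (i : S.Stream) : Measure ℝ :=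
  expMeasure (S.serviceRate i.regime)

theorem regimeRate_nonneg (S : ServiceSystem A R) (r : R) : 0 ≤ S.regimeRate r :=
  Finset.sum_nonneg fun a _ => S.rate_nonneg a r

theorem serviceRate_pos (S : ServiceSystem A R) (r : R) : 0 < S.serviceRate r :=
  (S.regimeRate_nonneg r).trans_lt (S.stable r)

theorem streamRate_pos (S : ServiceSystem A R) (i : S.Stream) : 0 < S.streamRate i := i.2

instance (S : ServiceSystem A R) (i : S.Stream) : IsProbabilityMeasure (S.streamService i) :=
  isProbabilityMeasure_expMeasure (S.serviceRate_pos _)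

open Classical in
/-- The streams routed to a regime. -/
noncomputable def regimeStreams (S : ServiceSystem A R) (r : R) : Finset S.Stream :=
  Finset.univ.filter fun i => i.regime = r

open Classical in
/-- The streams originating at a demand point. -/
noncomputable def originStreams (S : ServiceSystem A R) (a : A) : Finset S.Stream :=
  Finset.univ.filter fun i => i.origin = a

theorem mem_regimeStreams (S : ServiceSystem A R) {r : R} {i : S.Stream} :
    i ∈ S.regimeStreams r ↔ i.regime = r := by simp [regimeStreams]

theorem mem_originStreams (S : ServiceSystem A R) {a : A} {i : S.Stream} :
    i ∈ S.originStreams a ↔ i.origin = a := by simp [originStreams]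

namespace Input

variable {S : ServiceSystem A R} {Ω : Type*} [MeasurableSpace Ω] {P : Measure Ω}

/-- The (gap, service time) pairs of all streams. -/
def path (X : S.Input P) (ω : Ω) : S.Stream → ℕ → ℝ × ℝ :=
  fun i k => (X.gap i k ω, X.service i k ω)

/-- The arrival time of the customer preceding the `n`-th customer of the whole system. -/
noncomputable def prevEpoch (X : S.Input P) (ω : Ω) : ℕ → ℝ
  | 0 => 0
  | n + 1 => X.epoch n ω

theorem firstStream_eq_stream (X : S.Input P) (ω : Ω) (n : ℕ) {x : S.Stream → ℕ → ℝ × ℝ}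
    (hx : ∀ i, (x i 0).1 = X.arrivalTime i (X.count ω n i) ω - X.prevEpoch ω n) :
    firstStream x = X.stream n ω :=
  (congrArg argmin (funext hx)).trans (argmin_sub_const _ _)

/-- After `n` shifts the first gap of each stream is the time from the last arrival of the whole
system to its next point, and everything later is untouched. This holds for every `ω`, ties
included. -/
theorem iterate_shiftStreams_path (X : S.Input P) (ω : Ω) (n : ℕ) (i : S.Stream) :
    (∀ k, shiftStreams^[n] (X.path ω) i (k + 1) = (X.gap i (X.count ω n i + (k + 1)) ω,
      X.service i (X.count ω n i + (k + 1)) ω)) ∧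
    shiftStreams^[n] (X.path ω) i 0 =
      (X.arrivalTime i (X.count ω n i) ω - X.prevEpoch ω n,
        X.service i (X.count ω n i) ω) := by
  classical
  induction n generalizing i with
  | zero => simp [path, count, prevEpoch, arrivalTime]
  | succ n ih =>
    have hs : firstStream (shiftStreams^[n] (X.path ω)) = X.stream n ω :=
      X.firstStream_eq_stream ω n fun i => by rw [(ih i).2]
    have hd : (shiftStreams^[n] (X.path ω) (X.stream n ω) 0).1 =
        X.epoch n ω - X.prevEpoch ω n := by rw [(ih _).2]; rfl
    have hcount : X.count ω (n + 1) i =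
        X.count ω n i + if i = X.stream n ω then 1 else 0 := by
      simp only [count, stream]
      congr
    rw [Function.iterate_succ_apply', shiftStreams, hs, hd]
    simp only [removeFirst]
    by_cases hi : i = X.stream n ω
    · rw [hcount, if_pos hi]
      simp only [if_pos hi]
      refine ⟨fun k => ?_, ?_⟩
      · rw [(ih i).1, show X.count ω n i + 1 + (k + 1) = X.count ω n i + (k + 1 + 1) by ring]
      · rw [(ih i).1]
        simp only [prevEpoch, zero_add]
        rw [arrivalTime, Finset.sum_range_succ, ← arrivalTime]
        refine Prod.ext ?_ rfl
        simp only [epoch, ← hi]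
        ring
    · rw [hcount, if_neg hi]
      simp only [if_neg hi, add_zero]
      refine ⟨fun k => ?_, ?_⟩
      · rw [← (ih i).1]; rfl
      · change ((shiftStreams^[n] (X.path ω) i 0).1 - _, (shiftStreams^[n] (X.path ω) i 0).2) = _
        rw [(ih i).2]
        refine Prod.ext ?_ rfl
        simp only [prevEpoch]
        ring

theorem nthCustomer_path (X : S.Input P) (ω : Ω) (n : ℕ) :
    nthCustomer n (X.path ω) =
      (X.epoch n ω - X.prevEpoch ω n, X.stream n ω, X.serviceTime n ω) := by
  have hs : firstStream (shiftStreams^[n] (X.path ω)) = X.stream n ω :=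
    X.firstStream_eq_stream ω n fun i => by rw [(X.iterate_shiftStreams_path ω n i).2]
  rw [nthCustomer, firstCustomer, hs, (X.iterate_shiftStreams_path ω n _).2]
  rfl

/-- `queueStep` records the work just after an arrival and `workload` the work just before the next
one. Time `0` plays the part of an arrival that leaves the initial work. -/
theorem remainingWork_iterate (X : S.Input P) (ω : Ω) (r : R) (n : ℕ) :
    remainingWork ((queueStep (workFor (S.regimeStreams r)))^[n] (X.init r ω, X.path ω)) =
      X.workload ω n r := by
  classical
  have hc : ∀ n, firstCustomer
      ((queueStep (workFor (S.regimeStreams r)))^[n] (X.init r ω, X.path ω)).2 =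
      (X.epoch n ω - X.prevEpoch ω n, X.stream n ω, X.serviceTime n ω) := fun n => by
    rw [iterate_queueStep_snd, ← nthCustomer_path]; rfl
  induction n with
  | zero =>
    rw [remainingWork, hc]
    simp [workload, prevEpoch]
  | succ n ih =>
    rw [remainingWork, hc, Function.iterate_succ_apply', queueStep, ih, hc]
    simp only [workload, workFor, mem_regimeStreams, prevEpoch]

theorem markIndex_originStreams (X : S.Input P) (ω : Ω) (a : A) (n : ℕ) :
    markIndex {z | z.1 ∈ S.originStreams a} n (X.path ω) = X.indexFrom a n ω := by
  simp only [markIndex, nthCustomer_path, indexFrom, Set.mem_ofPred_eq, mem_originStreams]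

theorem markIndex_univ (X : S.Input P) (ω : Ω) (n : ℕ) :
    markIndex {z | z.1 ∈ (Finset.univ : Finset S.Stream)} n (X.path ω) = n := by
  simp [markIndex]

theorem path_mem_sojournEvent (X : S.Input P) (ω : Ω) (r : R) (O : Finset S.Stream) (n : ℕ)
    (B : Set ℝ) : (X.init r ω, X.path ω) ∈ sojournEvent (S.regimeStreams r) O n B ↔
      (X.stream (markIndex {z | z.1 ∈ O} n (X.path ω)) ω).regime = r ∧
        X.sojourn (markIndex {z | z.1 ∈ O} n (X.path ω)) ω ∈ B := by
  simp only [sojournEvent, Set.mem_ofPred_eq]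
  generalize markIndex {z | z.1 ∈ O} n (X.path ω) = k
  have hc := X.nthCustomer_path ω k
  rw [nthCustomer, firstCustomer] at hc
  simp only [Prod.mk.injEq] at hc
  rw [remainingWork_iterate, iterate_queueStep_snd, firstCustomer, hc.2.1, mem_regimeStreams]
  rw [hc.2.1] at hc
  rw [hc.2.2]
  refine and_congr_right fun h => ?_
  rw [sojourn, h]

theorem map_pi_bool_prod (m : Bool → Measure ℝ) [∀ b, IsProbabilityMeasure (m b)] :
    (Measure.pi m).map (fun u => (u false, u true)) = (m false).prod (m true) := by
  refine (Measure.prod_eq fun s t hs ht => ?_).symm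
  have h : (fun u : Bool → ℝ => (u false, u true)) ⁻¹' s ×ˢ t =
      Set.univ.pi fun b => if b then t else s := by
    ext u; simp
  rw [Measure.map_apply (by fun_prop) (hs.prod ht), h, Measure.pi_pi, Fintype.prod_bool, mul_comm]
  rfl

/-- The independent family of gaps and services is reindexed by (stream, index, kind) and curried
twice, first into pairs and then into sequences. -/
theorem hasLaw_path (X : S.Input P) [IsProbabilityMeasure P] :
    HasLaw X.path (streamsLaw S.streamRate S.streamService) P := by
  let e : (S.Stream × ℕ) × Bool → (S.Stream × ℕ) ⊕ (S.Stream × ℕ) := fun p =>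
    if p.2 then Sum.inr p.1 else Sum.inl p.1
  have he : Function.Injective e := by
    rintro ⟨p, b⟩ ⟨p', b'⟩ h
    cases b <;> cases b' <;> simp_all [e]
  let law : S.Stream × ℕ → Bool → Measure ℝ := fun p b =>
    if b then S.streamService p.1 else expMeasure (S.streamRate p.1)
  have hexp := fun i => isProbabilityMeasure_expMeasure (S.streamRate_pos i)
  have hlaw : ∀ p b, IsProbabilityMeasure (law p b) := fun p b => by
    cases b
    · exact hexp p.1
    · exact inferInstanceAs (IsProbabilityMeasure (S.streamService p.1))
  let f : (S.Stream × ℕ) × Bool → Ω → ℝ := fun p => Sum.elim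
    (fun p : S.Stream × ℕ => X.gap p.1 p.2) (fun p : S.Stream × ℕ => X.service p.1 p.2) (e p)
  have hf : iIndepFun f P := X.indep.precomp he
  have hfl : ∀ p, HasLaw (f p) (law p.1 p.2) P := by
    rintro ⟨p, b⟩
    cases b
    · exact X.gap_law p.1 p.2
    · exact X.service_law p.1 p.2
  have h1 : HasLaw (fun ω p => f p ω)
      (Measure.infinitePi fun p : (S.Stream × ℕ) × Bool => law p.1 p.2) P :=
    hf.hasLaw_infinitePi hfl (aemeasurable_pi_lambda _ fun p => (hfl p).aemeasurable)
  have h2 : MeasurePreserving (MeasurableEquiv.curry (S.Stream × ℕ) Bool ℝ)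
      (Measure.infinitePi fun p : (S.Stream × ℕ) × Bool => law p.1 p.2)
      (Measure.infinitePi fun p => Measure.infinitePi fun b => law p b) :=
    ⟨MeasurableEquiv.measurable _, Measure.infinitePi_map_curry law⟩
  have h3 : MeasurePreserving
      (fun (u : S.Stream × ℕ → Bool → ℝ) p => ((u p false, u p true) : ℝ × ℝ))
      (Measure.infinitePi fun p => Measure.infinitePi fun b => law p b)
      (Measure.infinitePi fun p : S.Stream × ℕ =>
        (expMeasure (S.streamRate p.1)).prod (S.streamService p.1)) := by
    refine ⟨by fun_prop, ?_⟩
    have := Measure.infinitePi_map_pi (μ := fun p => Measure.infinitePi fun b => law p b)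
      (f := fun _ (u : Bool → ℝ) => ((u false, u true) : ℝ × ℝ)) (fun _ => by fun_prop)
    rw [this]
    congr 1
    funext p
    rw [Measure.infinitePi_eq_pi, map_pi_bool_prod]
    rfl
  have h4 : MeasurePreserving (MeasurableEquiv.curry S.Stream ℕ (ℝ × ℝ))
      (Measure.infinitePi fun p : S.Stream × ℕ =>
        (expMeasure (S.streamRate p.1)).prod (S.streamService p.1))
      (streamsLaw S.streamRate S.streamService) := by
    refine ⟨MeasurableEquiv.measurable _, ?_⟩
    rw [Measure.infinitePi_map_curry fun (i : S.Stream) (_ : ℕ) =>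
      (expMeasure (S.streamRate i)).prod (S.streamService i), Measure.infinitePi_eq_pi]
    rfl
  exact (h4.comp (h3.comp h2)).comp_hasLaw h1

end Input

end ServiceSystem

/-! ### Aggregate rates as sums over streams -/

namespace ServiceSystem

variable {A R : Type*} [Fintype A] [Fintype R]

/-- Pairs that are not streams have rate zero, so they may be added to the sum. -/
theorem sum_stream (S : ServiceSystem A R) (p : A × R → Prop) [DecidablePred p]
    [DecidablePred fun i : S.Stream => p i.1] :
    ∑ i : S.Stream with p i.1, S.streamRate i = ∑ q : A × R, if p q then S.rate q.1 q.2 else 0 := by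
  classical
  rw [Finset.sum_filter]
  have h := Finset.sum_subtype (F := inferInstanceAs (Fintype S.Stream)) (Finset.univ.filter fun q : A × R => 0 < S.rate q.1 q.2)
    (p := fun q => 0 < S.rate q.1 q.2) (fun q => by simp)
    (fun q => if p q then S.rate q.1 q.2 else 0)
  refine Eq.trans ?_ (h.symm.trans ?_)
  · refine Finset.sum_congr (by ext; simp) fun i _ => ?_
    split_ifs <;> rfl
  · refine Finset.sum_subset (Finset.subset_univ _) fun q _ hq => ?_
    have : S.rate q.1 q.2 = 0 :=
      le_antisymm (not_lt.1 (by simpa using hq)) (S.rate_nonneg _ _)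
    simp [this]

theorem sum_regimeStreams (S : ServiceSystem A R) (r : R) :
    ∑ i ∈ S.regimeStreams r, S.streamRate i = S.regimeRate r := by
  classical
  have h := S.sum_stream fun q => q.2 = r
  rw [Fintype.sum_prod_type] at h
  refine Eq.trans ?_ (h.trans ?_)
  · refine Finset.sum_congr ?_ fun _ _ => rfl
    ext i; simp [mem_regimeStreams, Stream.regime]
  · simp [regimeRate]

theorem sum_originStreams (S : ServiceSystem A R) (a : A) :
    ∑ i ∈ S.originStreams a, S.streamRate i = S.demandRate a := by
  classical
  have h := S.sum_stream fun q => q.1 = a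
  rw [Fintype.sum_prod_type] at h
  refine Eq.trans ?_ (h.trans ?_)
  · refine Finset.sum_congr ?_ fun _ _ => rfl
    ext i; simp [mem_originStreams, Stream.origin]
  · simp [demandRate]

theorem sum_originStreams_inter_regimeStreams (S : ServiceSystem A R) (a : A) (r : R) :
    ∑ i ∈ S.originStreams a ∩ S.regimeStreams r, S.streamRate i = S.rate a r := by
  classical
  have h := S.sum_stream fun q => q = (a, r)
  refine Eq.trans ?_ (h.trans ?_)
  · refine Finset.sum_congr ?_ fun _ _ => rfl
    ext i
    simp [mem_originStreams, mem_regimeStreams, Stream.origin, Stream.regime, Prod.ext_iff]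
  · simp

theorem sum_streamRate (S : ServiceSystem A R) :
    ∑ i, S.streamRate i = ∑ r, S.regimeRate r := by
  classical
  have h := S.sum_stream fun _ => True
  rw [Fintype.sum_prod_type_right] at h
  simpa [regimeRate] using h

theorem sum_regimeRate_pos (S : ServiceSystem A R) : 0 < ∑ r, S.regimeRate r := by
  rw [← sum_streamRate]
  exact sum_rate_pos S.streamRate_pos

theorem weight_nonneg (S : ServiceSystem A R) (r : R) : 0 ≤ S.weight r :=
  div_nonneg (S.regimeRate_nonneg r) S.sum_regimeRate_pos.le

theorem sum_weight (S : ServiceSystem A R) : ∑ r, S.weight r = 1 := by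
  simp only [weight]
  rw [← Finset.sum_div, div_self S.sum_regimeRate_pos.ne']

theorem sum_regimeStreams_div (S : ServiceSystem A R) (r : R) :
    (∑ i ∈ S.regimeStreams r, S.streamRate i) / ∑ i, S.streamRate i = S.weight r := by
  rw [sum_regimeStreams, sum_streamRate, weight]

theorem originStreams_nonempty (S : ServiceSystem A R) {a : A} (ha : 0 < S.demandRate a) :
    (S.originStreams a).Nonempty := by
  rw [Finset.nonempty_iff_ne_empty]
  intro h
  rw [← sum_originStreams, h, Finset.sum_empty] at ha
  exact lt_irrefl _ ha

end ServiceSystem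

/-! ### Hyperexponential laws -/

section Hyperexponential

variable {ι : Type*} [Fintype ι] {w θ : ι → ℝ}

theorem isProbabilityMeasure_hyperexponential (hw : ∀ i, 0 ≤ w i) (hw1 : ∑ i, w i = 1)
    (hθ : ∀ i, 0 < θ i) : IsProbabilityMeasure (hyperexponential w θ) := by
  have := fun i => isProbabilityMeasure_expMeasure (hθ i)
  refine ⟨?_⟩
  simp only [hyperexponential, Measure.finsetSum_apply, Measure.smul_apply, measure_univ,
    smul_eq_mul, mul_one]
  rw [← ENNReal.ofReal_sum_of_nonneg fun i _ => hw i, hw1, ENNReal.ofReal_one]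

theorem hyperexponential_real_apply (hw : ∀ i, 0 ≤ w i) (hθ : ∀ i, 0 < θ i) (B : Set ℝ) :
    (hyperexponential w θ).real B = ∑ i, w i * (expMeasure (θ i)).real B := by
  have := fun i => isProbabilityMeasure_expMeasure (hθ i)
  simp only [measureReal_def, hyperexponential, Measure.finsetSum_apply, Measure.smul_apply,
    smul_eq_mul]
  rw [ENNReal.toReal_sum fun i _ => ENNReal.mul_ne_top ENNReal.ofReal_ne_top (measure_ne_top _ _)]
  simp [ENNReal.toReal_mul, ENNReal.toReal_ofReal (hw _)]

theorem hyperexponential_real_Iic (hw : ∀ i, 0 ≤ w i) (hw1 : ∑ i, w i = 1)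
    (hθ : ∀ i, 0 < θ i) (x : ℝ) :
    (hyperexponential w θ).real (Set.Iic x) =
      1 - ∑ i, w i * Real.exp (-(θ i * max x 0)) := by
  rw [hyperexponential_real_apply hw hθ, ← hw1, ← Finset.sum_sub_distrib]
  refine Finset.sum_congr rfl fun i _ => ?_
  have : 0 ≤ θ i * max x 0 := mul_nonneg (hθ i).le (le_max_right _ _)
  have := Real.exp_le_one_iff.2 (neg_nonpos.2 this)
  rw [measureReal_def, expMeasure_Iic (hθ i), ENNReal.toReal_ofReal (by linarith)]
  ring

theorem integrable_id_hyperexponential (hθ : ∀ i, 0 < θ i) :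
    Integrable (fun x : ℝ => x) (hyperexponential w θ) :=
  integrable_finsetSum_measure.2 fun i _ =>
    (integrable_id_expMeasure (hθ i)).smul_measure ENNReal.ofReal_ne_top

theorem integral_id_hyperexponential (hw : ∀ i, 0 ≤ w i) (hθ : ∀ i, 0 < θ i) :
    ∫ x, x ∂hyperexponential w θ = ∑ i, w i / θ i := by
  rw [hyperexponential, integral_finsetSum_measure fun i _ =>
    (integrable_id_expMeasure (hθ i)).smul_measure ENNReal.ofReal_ne_top]
  refine Finset.sum_congr rfl fun i _ => ?_
  rw [integral_smul_measure, integral_id_expMeasure (hθ i), ENNReal.toReal_ofReal (hw i),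
    smul_eq_mul, mul_one_div]

end Hyperexponential

/-! ### Convergence of the response times -/

/-- Setwise convergence of laws implies convergence in distribution. -/
theorem tendstoInDistribution_of_forall_measureReal {Ω : Type*} [MeasurableSpace Ω]
    {P : Measure Ω} [IsProbabilityMeasure P] {Y : ℕ → Ω → ℝ} (hY : ∀ n, AEMeasurable (Y n) P)
    {ν : Measure ℝ} [IsProbabilityMeasure ν]
    (h : ∀ B, MeasurableSet B → Tendsto (fun n => P.real (Y n ⁻¹' B)) atTop (𝓝 (ν.real B))) :
    TendstoInDistribution Y atTop (id : ℝ → ℝ) (fun _ => P) ν where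
  forall_aemeasurable := hY
  aemeasurable_limit := aemeasurable_id
  tendsto := by
    refine tendsto_of_forall_isOpen_le_liminf' fun G hG => ?_
    have ht : Tendsto (fun n => (P.map (Y n)) G) atTop (𝓝 (ν G)) := by
      have := (ENNReal.continuous_ofReal.tendsto _).comp (h G hG.measurableSet)
      rw [ofReal_measureReal] at this
      refine this.congr fun n => ?_
      rw [Measure.map_apply_of_aemeasurable (hY n) hG.measurableSet, Function.comp,
        ofReal_measureReal]
    simp only [ProbabilityMeasure.coe_mk, Measure.map_id]
    exact ht.liminf_eq.ge

namespace ServiceSystem.Input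

variable {A R : Type*} [Fintype A] [Fintype R] {S : ServiceSystem A R} {Ω : Type*}
  [MeasurableSpace Ω] {P : Measure Ω} [IsProbabilityMeasure P]

theorem aemeasurable_init_path (X : S.Input P) (r : R) :
    AEMeasurable (fun ω => (X.init r ω, X.path ω)) P :=
  (X.init_aemeasurable r).prodMk X.hasLaw_path.aemeasurable

omit [IsProbabilityMeasure P] in
theorem preimage_sojourn (X : S.Input P) (O : Finset S.Stream) (n : ℕ) (B : Set ℝ) :
    (fun ω => X.sojourn (markIndex {z | z.1 ∈ O} n (X.path ω)) ω) ⁻¹' B =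
      ⋃ r ∈ (Finset.univ : Finset R), (fun ω => (X.init r ω, X.path ω)) ⁻¹'
        sojournEvent (S.regimeStreams r) O n B := by
  ext ω
  simp only [Set.mem_preimage, Set.mem_iUnion, path_mem_sojournEvent]
  simp

theorem aemeasurable_sojourn (X : S.Input P) (O : Finset S.Stream) (n : ℕ) :
    AEMeasurable (fun ω => X.sojourn (markIndex {z | z.1 ∈ O} n (X.path ω)) ω) P := by
  refine NullMeasurable.aemeasurable fun B hB => ?_
  rw [preimage_sojourn]
  exact Finset.nullMeasurableSet_biUnion _ fun r _ => (X.aemeasurable_init_path r).nullMeasurable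
    (measurableSet_sojournEvent _ O n hB)

/-- The sojourn times of the successive customers of the streams in `O` converge in law if the
regimes of these customers have the law of the regime of an arbitrary customer. -/
theorem tendsto_measureReal_sojourn (X : S.Input P) {O : Finset S.Stream} (hO0 : O.Nonempty)
    (hO : ∀ r, ∑ i ∈ O ∩ S.regimeStreams r, S.streamRate i =
      S.weight r * ∑ i ∈ O, S.streamRate i) {B : Set ℝ} (hB : MeasurableSet B) :
    Tendsto (fun n => P.real
      ((fun ω => X.sojourn (markIndex {z | z.1 ∈ O} n (X.path ω)) ω) ⁻¹' B)) atTop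
      (𝓝 ((hyperexponential S.weight fun r => S.serviceRate r - S.regimeRate r).real B)) := by
  have hmeas := X.aemeasurable_init_path
  have hprob := fun r => Measure.isProbabilityMeasure_map (hmeas r)
  have hsnd : ∀ r, (P.map fun ω => (X.init r ω, X.path ω)).map Prod.snd =
      streamsLaw S.streamRate S.streamService := fun r => by
    rw [AEMeasurable.map_map_of_aemeasurable measurable_snd.aemeasurable (hmeas r)]
    exact X.hasLaw_path.map_eq
  have hθ : ∀ r, 0 < S.serviceRate r - S.regimeRate r := fun r => sub_pos.2 (S.stable r)
  rw [hyperexponential_real_apply S.weight_nonneg hθ]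
  have hterm : ∀ r, Tendsto (fun n => P.real ((fun ω => (X.init r ω, X.path ω)) ⁻¹'
      sojournEvent (S.regimeStreams r) O n B)) atTop
      (𝓝 (S.weight r * (expMeasure (S.serviceRate r - S.regimeRate r)).real B)) := by
    intro r
    have h := tendsto_measure_sojournEvent (K := S.regimeStreams r) (μ := S.serviceRate r)
      S.streamRate_pos (by rw [sum_regimeStreams]; exact S.stable r)
      (fun i hi => by rw [streamService, S.mem_regimeStreams.1 hi]) O hO0
      (by rw [sum_regimeStreams_div]; exact hO r) (hsnd r) hB
    rw [sum_regimeStreams_div, sum_regimeStreams] at h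
    refine h.congr fun n => ?_
    rw [measureReal_def, Measure.map_apply_of_aemeasurable (hmeas r)
      (measurableSet_sojournEvent _ O n hB)]
    rfl
  -- The events for different regimes are disjoint because a customer joins only one queue, so the
  -- limits for the separate queues add up.
  refine (tendsto_finsetSum Finset.univ fun r _ => hterm r).congr fun n => ?_
  rw [preimage_sojourn, measureReal_def, measure_biUnion_finset₀]
  · rw [ENNReal.toReal_sum fun _ _ => measure_ne_top _ _]
    rfl
  · intro r _ r' _ hr
    refine (Set.disjoint_left.2 fun ω h h' => hr ?_).aedisjoint
    rw [← ((X.path_mem_sojournEvent ω r O n B).1 h).1,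
      ((X.path_mem_sojournEvent ω r' O n B).1 h').1]
  · exact fun r _ => (hmeas r).nullMeasurable (measurableSet_sojournEvent _ O n hB)

end ServiceSystem.Input

/-- For every demand point `a` there is a law `ν` of the end-to-end response time `R_a`. It is the
steady-state law of `t_a` plus the sojourn time of an arbitrary customer of the system and, if the
customers of `a` are routed by the regime probabilities (`λ_{ar} = π_r λ_a` with `λ_a > 0`), also
that of `t_a` plus the sojourn time of an arbitrary customer originating at `a` itself. This law is
the hyperexponential law shifted by `t_a`, with the stated distribution function and mean. -/
theorem mainTheorem1 {A R : Type*} [Fintype A] [Fintype R] (S : ServiceSystem A R)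
    {Ω : Type*} [MeasurableSpace Ω] (P : Measure Ω) [IsProbabilityMeasure P] (X : S.Input P)
    (a : A) :
    ∃ ν : ProbabilityMeasure ℝ,
      TendstoInDistribution (fun (n : ℕ) ω => S.travel a + X.sojourn n ω) atTop
        (id : ℝ → ℝ) (fun _ => P) (ν : Measure ℝ) ∧
      (0 < S.demandRate a → (∀ r, S.rate a r = S.weight r * S.demandRate a) →
        TendstoInDistribution
          (fun (n : ℕ) ω => S.travel a + X.sojourn (X.indexFrom a n ω) ω) atTop
          (id : ℝ → ℝ) (fun _ => P) (ν : Measure ℝ)) ∧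
      (ν : Measure ℝ) =
        (hyperexponential S.weight fun r => S.serviceRate r - S.regimeRate r).map
          (fun x => S.travel a + x) ∧
      (∀ t : ℝ, (ν : Measure ℝ).real (Set.Iic t) =
        if t < S.travel a then 0
        else 1 - ∑ r, S.weight r *
          Real.exp (-(S.serviceRate r - S.regimeRate r) * (t - S.travel a))) ∧
      Integrable (fun x : ℝ => x) (ν : Measure ℝ) ∧
      ∫ x, x ∂(ν : Measure ℝ) =
        S.travel a + ∑ r, S.weight r / (S.serviceRate r - S.regimeRate r) := by
  have hθ : ∀ r, 0 < S.serviceRate r - S.regimeRate r := fun r => sub_pos.2 (S.stable r)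
  have hw := S.weight_nonneg
  have hyp := isProbabilityMeasure_hyperexponential hw S.sum_weight hθ
  have hadd : Measurable fun x : ℝ => S.travel a + x := measurable_const_add _
  set H := hyperexponential S.weight fun r => S.serviceRate r - S.regimeRate r with hH
  have hν := Measure.isProbabilityMeasure_map (μ := H) hadd.aemeasurable
  have hreal : ∀ B, MeasurableSet B → (H.map fun x => S.travel a + x).real B =
      H.real ((fun x => S.travel a + x) ⁻¹' B) := fun B hB => by
    rw [measureReal_def, Measure.map_apply hadd hB]; rfl
  have hconv : ∀ O : Finset S.Stream, O.Nonempty →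
      (∀ r, ∑ i ∈ O ∩ S.regimeStreams r, S.streamRate i =
        S.weight r * ∑ i ∈ O, S.streamRate i) →
      TendstoInDistribution
        (fun (n : ℕ) ω => S.travel a + X.sojourn (markIndex {z | z.1 ∈ O} n (X.path ω)) ω) atTop
        (id : ℝ → ℝ) (fun _ => P) (H.map fun x => S.travel a + x) := fun O hO0 hO => by
    refine tendstoInDistribution_of_forall_measureReal
      (fun n => (X.aemeasurable_sojourn O n).const_add _) fun B hB => ?_
    rw [hreal B hB]
    exact X.tendsto_measureReal_sojourn hO0 hO (hadd hB)
  refine ⟨⟨H.map fun x => S.travel a + x, hν⟩, ?_, fun ha hrate => ?_, rfl, fun t => ?_, ?_, ?_⟩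
  -- For the class of all customers the proportionality condition is the definition of the weights.
  · have h := hconv Finset.univ Finset.univ_nonempty fun r => by
      rw [Finset.univ_inter, ← S.sum_regimeStreams_div,
        div_mul_cancel₀ _ (sum_rate_pos S.streamRate_pos).ne']
    simp only [X.markIndex_univ] at h
    exact h
  -- For the customers of `a` the proportionality condition is the routing hypothesis.
  · have h := hconv (S.originStreams a) (S.originStreams_nonempty ha) fun r => by
      rw [S.sum_originStreams_inter_regimeStreams, S.sum_originStreams, hrate r]
    simp only [X.markIndex_originStreams] at h
    exact h
  · have hpre : (fun x => S.travel a + x) ⁻¹' Set.Iic t = Set.Iic (t - S.travel a) := by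
      ext x; simp [le_sub_iff_add_le']
    rw [ProbabilityMeasure.coe_mk, hreal _ measurableSet_Iic, hpre, hH,
      hyperexponential_real_Iic hw S.sum_weight hθ]
    split_ifs with ht
    · simp [max_eq_right (sub_neg.2 ht).le, S.sum_weight]
    · simp only [max_eq_left (sub_nonneg.2 (not_lt.1 ht)), neg_mul]
  · rw [ProbabilityMeasure.coe_mk, integrable_map_measure (by fun_prop) hadd.aemeasurable]
    exact (integrable_const _).add (integrable_id_hyperexponential hθ)
  · rw [ProbabilityMeasure.coe_mk, integral_map hadd.aemeasurable (by fun_prop),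
      integral_add (integrable_const _) (integrable_id_hyperexponential hθ),
      integral_id_hyperexponential hw hθ]
    simp
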